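/- Let $\mathbb{F}\ell(2,4;6)$ be the manifold of flags $E_\bullet = (E_2\subset E_4\subset\mathbb{C}^6)$ with $\dim E_i=i$. For a complete flag $F_\bullet$ in $\mathbb{C}^6$, a permutation $w$ of $\{1,\dots,6\}$ with descents only at positions $2$ and $4$, and $r_w(i,j)=\#\{l\le i\mid j+w(l)>6\}$, let $$X_wF_\bullet=\{E_\bullet\mid \dim(E_i\cap F_j)\ge r_w(i,j)\ \text{for } i\in\{2,4\},\ 1\le j\le 6\}$$ be the Schubert variety, which has codimension the length (number of inversions) $\ell(w)$ of $w$. For $t\in\mathbb{R}$ let $F_\bullet(t)$ be the flag osculating the rational normal curve $\gamma(t)=(t^5,t^4,t^3,t^2,t,1)$ at $t$, i.e. $F_j(t)=\operatorname{span}\{\gamma(t),\gamma'(t),\dots,\gamma^{(j-1)}(t)\}$; for $t=\infty$ use instead the parametrization $s\mapsto(1,s,s^2,s^3,s^4,s^5)$ of the curve near $\infty$ and its derivatives at $s=0$. Write $X_w(t)=X_wF_\bullet(t)$. **Theorem.** For any four distinct points $s,t,u,v\in\mathbb{RP}^1=\mathbb{R}\cup\{\infty\}$, the intersection $$X_{142536}(s)\cap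 X_{142536}(t)\cap X_{142536}(u)\cap X_{142536}(v)\subset\mathbb{F}\ell(2,4;6)$$ consists of exactly $6$ points; all of them are real (both subspaces $E_2$ and $E_4$ are complexifications of subspaces of $\mathbb{R}^6$); and the intersection is transverse at each of them, that is, each of the four Schubert varieties is smooth at the point, and the codimension of the intersection of their four tangent spaces in the tangent space of $\mathbb{F}\ell(2,4;6)$ is the sum of their codimensions. -/

import Mathlib

noncomputable section

/-- Partial flags of type `a = (a₁ < ⋯ < a_k)` in `ℂⁿ`: the points of `𝔽ℓ(a; n)`. -/
@[ext]
structure PartialFlag {k : ℕ} (a : Fin k → ℕ) (n : ℕ) where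
  /-- The `i`-th subspace of the flag. -/
  space : Fin k → Submodule ℂ (Fin n → ℂ)
  mono : Monotone space
  finrank_eq : ∀ i, Module.finrank ℂ (space i) = a i

/-- The rank function `r_w(i, j) = #{l ≤ i ∣ j + w(l) > n}` of a permutation `w` of `{1, …, n}`.
Permutations act on `Fin n = {0, …, n - 1}`, so the usual one-based position and value are
`l + 1` and `w l + 1`. -/
def rankFn {n : ℕ} (w : Equiv.Perm (Fin n)) (i j : ℕ) : ℕ :=
  (Finset.univ.filter fun l : Fin n => (l : ℕ) + 1 ≤ i ∧ n < j + ((w l : ℕ) + 1)).card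

/-- The length `ℓ(w)`: the number of inversions of `w`. -/
def permLength {n : ℕ} (w : Equiv.Perm (Fin n)) : ℕ :=
  (Finset.univ.filter fun p : Fin n × Fin n => p.1 < p.2 ∧ w p.2 < w p.1).card

/-- The Schubert variety `X_w F_•` in `𝔽ℓ(a; n)`, where `F j` is the `j`-dimensional member of a
complete flag of `ℂⁿ`. -/
def schubertVariety {k n : ℕ} (a : Fin k → ℕ) (w : Equiv.Perm (Fin n))
    (F : ℕ → Submodule ℂ (Fin n → ℂ)) : Set (PartialFlag a n) :=
  {E | ∀ i : Fin k, ∀ j ∈ Finset.Icc 1 n,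
    rankFn w (a i) j ≤ Module.finrank ℂ ↥(E.space i ⊓ F j)}

/-- The rational normal curve `γ(t) = (tⁿ⁻¹, tⁿ⁻², …, t, 1)`. -/
def normalCurve (n : ℕ) (t : ℂ) : Fin n → ℂ := fun m => t ^ (n - 1 - (m : ℕ))

/-- The rational normal curve near `t = ∞` in the coordinate `s = 1 / t`:
`sⁿ⁻¹ γ(1 / s) = (1, s, …, sⁿ⁻¹)`. -/
def normalCurveAtInfty (n : ℕ) (s : ℂ) : Fin n → ℂ := fun m => s ^ (m : ℕ)

/-- The flag `F_•(t)` osculating the rational normal curve at a point `t` of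
`ℝℙ¹ = ℝ ∪ {∞}`: `F_j(t)` is spanned by the derivatives of order `< j` of the curve at `t`. -/
def osculatingFlag (n : ℕ) : OnePoint ℝ → ℕ → Submodule ℂ (Fin n → ℂ)
  | some t, j => Submodule.span ℂ {v | ∃ r < j, v = iteratedDeriv r (normalCurve n) (t : ℂ)}
  | none, j => Submodule.span ℂ {v | ∃ r < j, v = iteratedDeriv r (normalCurveAtInfty n) 0}

namespace PartialFlag

variable {k n : ℕ} {a : Fin k → ℕ}

/-- A flag is real if each of its subspaces is the complexification of a subspace of `ℝⁿ`. -/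
def IsReal (E : PartialFlag a n) : Prop :=
  ∀ i, ∃ W : Submodule ℝ (Fin n → ℝ),
    E.space i = Submodule.span ℂ ((fun (v : Fin n → ℝ) (m : Fin n) => (v m : ℂ)) '' W)

/-- The Lie algebra of the stabilizer of `E` in `GL_n(ℂ)`: the matrices that map every subspace
of `E` into itself. -/
def stabilizerAlgebra (E : PartialFlag a n) : Submodule ℂ (Matrix (Fin n) (Fin n) ℂ) where
  carrier := {A | ∀ i, ∀ v ∈ E.space i, A.mulVec v ∈ E.space i}
  zero_mem' := fun i v _ => by simp
  add_mem' := fun hA hB i v hv => by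
    rw [Matrix.add_mulVec]
    exact (E.space i).add_mem (hA i v hv) (hB i v hv)
  smul_mem' := fun c A hA i v hv => by
    rw [Matrix.smul_mulVec]
    exact (E.space i).smul_mem c (hA i v hv)

/-- The tangent space at `E` of the homogeneous space `𝔽ℓ(a; n) = GL_n(ℂ) / Stab(E)`. -/
abbrev TangentSpace (E : PartialFlag a n) : Type :=
  Matrix (Fin n) (Fin n) ℂ ⧸ E.stabilizerAlgebra

/-- The preimage of `X` under the orbit map `GL_n(ℂ) → 𝔽ℓ(a; n)`, `g ↦ g E`. -/
def orbitPreimage (X : Set (PartialFlag a n)) (E : PartialFlag a n) :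
    Set (Matrix (Fin n) (Fin n) ℂ) :=
  {g | IsUnit g.det ∧ ∃ E' ∈ X, ∀ i, E'.space i = (E.space i).map g.mulVecLin}

/-- The Zariski tangent space, at the identity matrix, of the preimage of `X` under the orbit map
of `E`: the common kernel of the differentials at the identity of all polynomials in the matrix
entries that vanish on this preimage. -/
def preimageTangent (X : Set (PartialFlag a n)) (E : PartialFlag a n) :
    Submodule ℂ (Matrix (Fin n) (Fin n) ℂ) where
  carrier := {A | ∀ f : MvPolynomial (Fin n × Fin n) ℂ,
    (∀ g ∈ orbitPreimage X E, MvPolynomial.eval (fun p => g p.1 p.2) f = 0) →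
    ∑ p : Fin n × Fin n,
      MvPolynomial.eval (fun q => (1 : Matrix (Fin n) (Fin n) ℂ) q.1 q.2)
        (MvPolynomial.pderiv p f) * A p.1 p.2 = 0}
  zero_mem' := fun f _ => by simp
  add_mem' := fun hA hB f hf => by
    simp only [Matrix.add_apply, mul_add, Finset.sum_add_distrib, hA f hf, hB f hf, add_zero]
  smul_mem' := fun c A hA f hf => by
    simp only [Matrix.smul_apply, smul_eq_mul, mul_left_comm _ c, ← Finset.mul_sum, hA f hf,
      mul_zero]

/-- The Zariski tangent space at `E ∈ X` of a closed subvariety `X` of `𝔽ℓ(a; n)`, as a subspace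
of the tangent space of `𝔽ℓ(a; n)`. The orbit map `GL_n(ℂ) → 𝔽ℓ(a; n)` of `E` is a smooth
surjection whose differential at the identity is the quotient map onto `TangentSpace E`, so the
tangent space of `X` is the image of the tangent space of the preimage of `X`. -/
def zariskiTangent (X : Set (PartialFlag a n)) (E : PartialFlag a n) :
    Submodule ℂ E.TangentSpace :=
  (preimageTangent X E).map E.stabilizerAlgebra.mkQ

/-- The Schubert varieties `X_{w_i} F^i_•` meet transversely at their common point `E`: each is
smooth at `E`, that is, the codimension of its Zariski tangent space is the codimension `ℓ(w_i)`
of the variety, and the tangent spaces are in general position, that is, the codimension of their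
intersection is the sum of their codimensions. -/
def TransverseAt {ι : Type*} [Fintype ι] (w : ι → Equiv.Perm (Fin n))
    (F : ι → ℕ → Submodule ℂ (Fin n → ℂ)) (E : PartialFlag a n) : Prop :=
  (∀ i, Module.finrank ℂ (E.TangentSpace ⧸ zariskiTangent (schubertVariety a (w i) (F i)) E) =
    permLength (w i)) ∧
  Module.finrank ℂ
      (E.TangentSpace ⧸ ⨅ i, zariskiTangent (schubertVariety a (w i) (F i)) E) =
    ∑ i, Module.finrank ℂ (E.TangentSpace ⧸ zariskiTangent (schubertVariety a (w i) (F i)) E)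

end PartialFlag

/-- The permutation `142536` of `{1, …, 6}` in one-line notation, shifted to `{0, …, 5}`. -/
def perm142536 : Equiv.Perm (Fin 6) where
  toFun := ![0, 3, 1, 4, 2, 5]
  invFun := ![0, 2, 4, 1, 3, 5]
  left_inv := by decide
  right_inv := by decide

end

/-!
The Schubert conditions of `142536` reduce to `dim (E₂ ∩ F₃) ≥ 1` and `dim (E₄ ∩ F₃) ≥ 2`
(`mem_schubertVariety_iff`), so that only the four subspaces `F₃(t)` matter.

Suppose that in suitable coordinates `(x, y) ∈ ℂ³ × ℂ³` these four subspaces are `y = 0`, `x = 0`,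
`y = x` and `y = κ x`, where `κ` is diagonal with distinct entries (`IsNormalForm`). A plane that
meets the first three subspaces is spanned by `(x, 0)` and `(0, x)` for some `x`, and it meets the
fourth if and only if `x` is an eigenvector of `κ`. So exactly three planes meet all four
subspaces, the blocks `P₁`, `P₂`, `P₃` spanned by `(e_k, 0)` and `(0, e_k)`. In the same way `E₄`
comes from a `κ`-invariant plane in `ℂ³`, and it is the sum of two blocks if it contains one. The
solutions are the six flags `P_j ⊂ P_j + P_k` with `j ≠ k`.

The Zariski tangent space of a Schubert variety at such a flag is the space of matrices that map
`E_i ∩ F₃` into `E_i + F₃`: such matrices are tangent because they are sums of infinitesimal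
automorphisms of `F₃` and of `E`, and there are no other tangent vectors because suitable `2 × 2`
and `3 × 3` minors vanish on the variety (`PartialFlag.preimageTangent_eq_vanishingEntries`). If
a matrix is tangent to all four varieties, its component from a block `P_j ⊂ E_i` to a block
`P_m ⊄ E_i` respects four lines; the first three make it a scalar, and since `κ_j ≠ κ_m` the scalar
is zero (`IsNormalForm.component_eq_zero`). So the matrix stabilizes the flag, and the
intersection of the four tangent spaces is zero, of codimension `12 = 4 · 3`.

It remains to find the normal form over `ℝ` (`exists_isNormalForm`). Identify `ℂ⁶` with the binary
quintics, so that `F₃(t)` consists of the multiples of `ℓ³`, where `ℓ` is the linear form of `t`.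
The four linear forms may be taken to be `x`, `y`, `x + y` and `x + λ y` with `λ` real and
`λ ≠ 0, 1`. The multiples of the last two cubes are the graphs of two maps from `x³ · (quadratics)`
to `y³ · (quadratics)`, and the quotient of these maps is `λ⁵ (R D⁻¹)²` for an explicit involution
`R` and `D = diag(1, λ, λ²)`. The characteristic polynomial of `R D⁻¹` is, up to scaling, a cubic
that has three distinct real roots by its signs at explicit points. The squares of the roots are
distinct as well: for `λ < 0` all roots are negative, and for `λ > 0` an algebraic identity excludes
opposite roots (`exists_roots_eigenCubic`).
-/

noncomputable section

open Matrix

/-! ### Zariski tangent spaces of orbit preimages -/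

/-- The differential at the identity matrix of a polynomial in the matrix entries, in the
direction `A`. -/
def differentialAtOne {n : ℕ} (A : Matrix (Fin n) (Fin n) ℂ)
    (f : MvPolynomial (Fin n × Fin n) ℂ) : ℂ :=
  ∑ p : Fin n × Fin n,
    MvPolynomial.eval (fun q => (1 : Matrix (Fin n) (Fin n) ℂ) q.1 q.2)
      (MvPolynomial.pderiv p f) * A p.1 p.2

section Differential

variable {n : ℕ} (A : Matrix (Fin n) (Fin n) ℂ)

theorem differentialAtOne_add (f g : MvPolynomial (Fin n × Fin n) ℂ) :
    differentialAtOne A (f + g) = differentialAtOne A f + differentialAtOne A g := by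
  simp [differentialAtOne, add_mul, Finset.sum_add_distrib]

theorem differentialAtOne_sub (f g : MvPolynomial (Fin n × Fin n) ℂ) :
    differentialAtOne A (f - g) = differentialAtOne A f - differentialAtOne A g := by
  simp [differentialAtOne, sub_mul, Finset.sum_sub_distrib]

theorem differentialAtOne_mul (f g : MvPolynomial (Fin n × Fin n) ℂ) :
    differentialAtOne A (f * g) =
      MvPolynomial.eval (fun q => (1 : Matrix (Fin n) (Fin n) ℂ) q.1 q.2) f *
          differentialAtOne A g +
        MvPolynomial.eval (fun q => (1 : Matrix (Fin n) (Fin n) ℂ) q.1 q.2) g *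
          differentialAtOne A f := by
  simp only [differentialAtOne, Derivation.leibniz, smul_eq_mul, map_add, map_mul, add_mul,
    Finset.sum_add_distrib, Finset.mul_sum, mul_assoc]

theorem differentialAtOne_C (c : ℂ) : differentialAtOne A (MvPolynomial.C c) = 0 := by
  simp [differentialAtOne]

theorem differentialAtOne_X (p : Fin n × Fin n) :
    differentialAtOne A (MvPolynomial.X p) = A p.1 p.2 := by
  simp [differentialAtOne, MvPolynomial.pderiv_X, Pi.single_apply, apply_ite,
    ite_mul]

/-- The restriction of a polynomial in the matrix entries to the line `ε ↦ 1 + ε A`. -/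
def restrictToLine (f : MvPolynomial (Fin n × Fin n) ℂ) : Polynomial ℂ :=
  MvPolynomial.aeval (fun p : Fin n × Fin n =>
    Polynomial.C ((1 : Matrix (Fin n) (Fin n) ℂ) p.1 p.2) +
      Polynomial.X * Polynomial.C (A p.1 p.2)) f

theorem eval_restrictToLine (f : MvPolynomial (Fin n × Fin n) ℂ) (ε : ℂ) :
    (restrictToLine A f).eval ε =
      MvPolynomial.eval (fun p => (1 + ε • A) p.1 p.2) f := by
  induction f using MvPolynomial.induction_on with
  | C a => simp [restrictToLine]
  | add f g hf hg => simp_all [restrictToLine]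
  | mul_X f p hf => simp_all [restrictToLine, mul_comm ε]

theorem differentialAtOne_eq_derivative (f : MvPolynomial (Fin n × Fin n) ℂ) :
    differentialAtOne A f = (restrictToLine A f).derivative.eval 0 := by
  induction f using MvPolynomial.induction_on with
  | C a => simp [restrictToLine, differentialAtOne_C]
  | add f g hf hg =>
    rw [differentialAtOne_add, hf, hg]
    simp [restrictToLine]
  | mul_X f p hf =>
    rw [differentialAtOne_mul, hf, differentialAtOne_X]
    have h0 := eval_restrictToLine A f 0
    simp only [zero_smul, add_zero] at h0
    rw [← h0]
    simp [restrictToLine, Polynomial.derivative_mul]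
    ring

/-- The matrix coefficient `g ↦ φ (g v)` as a polynomial in the entries of `g`. -/
def matrixCoeff (φ : (Fin n → ℂ) →ₗ[ℂ] ℂ) (v : Fin n → ℂ) : MvPolynomial (Fin n × Fin n) ℂ :=
  ∑ p : Fin n × Fin n, MvPolynomial.C (φ (Pi.single p.1 1) * v p.2) * MvPolynomial.X p

theorem linear_mulVec_eq_sum (φ : (Fin n → ℂ) →ₗ[ℂ] ℂ) (v : Fin n → ℂ)
    (g : Matrix (Fin n) (Fin n) ℂ) :
    φ (g *ᵥ v) = ∑ p : Fin n × Fin n, φ (Pi.single p.1 1) * v p.2 * g p.1 p.2 := by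
  rw [Fintype.sum_prod_type, LinearMap.pi_apply_eq_sum_univ φ (g *ᵥ v)]
  refine Finset.sum_congr rfl fun i _ => ?_
  rw [mulVec, dotProduct, smul_eq_mul, Finset.sum_mul]
  refine Finset.sum_congr rfl fun j _ => ?_
  have : (fun j => if i = j then (1 : ℂ) else 0) = Pi.single i 1 := by
    ext j; simp [Pi.single_apply, eq_comm]
  rw [this]
  ring

theorem eval_matrixCoeff (φ : (Fin n → ℂ) →ₗ[ℂ] ℂ) (v : Fin n → ℂ)
    (g : Matrix (Fin n) (Fin n) ℂ) :
    MvPolynomial.eval (fun p => g p.1 p.2) (matrixCoeff φ v) = φ (g *ᵥ v) := by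
  simp [matrixCoeff, linear_mulVec_eq_sum]

theorem eval_one_matrixCoeff (φ : (Fin n → ℂ) →ₗ[ℂ] ℂ) (v : Fin n → ℂ) :
    MvPolynomial.eval (fun p => (1 : Matrix (Fin n) (Fin n) ℂ) p.1 p.2) (matrixCoeff φ v) =
      φ v := by
  rw [eval_matrixCoeff, one_mulVec]

theorem differentialAtOne_matrixCoeff (φ : (Fin n → ℂ) →ₗ[ℂ] ℂ) (v : Fin n → ℂ) :
    differentialAtOne A (matrixCoeff φ v) = φ (A *ᵥ v) := by
  simp [matrixCoeff, differentialAtOne, linear_mulVec_eq_sum, MvPolynomial.pderiv_X,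
    Pi.single_apply, apply_ite]

end Differential

namespace PartialFlag

variable {k n : ℕ} {a : Fin k → ℕ}

/-- A matrix is tangent to an orbit preimage as soon as the line `1 + ε A` lies in it wherever it
is invertible: a polynomial vanishing on the preimage vanishes at infinitely many points of the
line, hence on all of it. -/
theorem mem_preimageTangent_of_line {X : Set (PartialFlag a n)} {E : PartialFlag a n}
    {A : Matrix (Fin n) (Fin n) ℂ}
    (h : ∀ ε : ℂ, IsUnit (1 + ε • A).det → 1 + ε • A ∈ orbitPreimage X E) :
    A ∈ preimageTangent X E := by
  intro f hf
  change differentialAtOne A f = 0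
  have hinf : {ε : ℂ | IsUnit (1 + ε • A).det}.Infinite := by
    apply infinite_of_mem_nhds (0 : ℂ)
    have hc : Continuous fun ε : ℂ => (1 + ε • A).det := by fun_prop
    have : ∀ᶠ ε in nhds (0 : ℂ), (1 + ε • A).det ≠ 0 :=
      hc.continuousAt.eventually_ne (by simp)
    filter_upwards [this] with ε hε using isUnit_iff_ne_zero.mpr hε
  have hzero : restrictToLine A f = 0 := by
    apply Polynomial.eq_zero_of_infinite_isRoot
    refine hinf.mono fun ε hε => ?_
    change (restrictToLine A f).eval ε = 0
    rw [eval_restrictToLine]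
    exact hf _ (h ε hε)
  rw [differentialAtOne_eq_derivative, hzero]
  simp

theorem mulVecLin_injective_of_isUnit_det {g : Matrix (Fin n) (Fin n) ℂ} (hg : IsUnit g.det) :
    Function.Injective g.mulVecLin :=
  Matrix.mulVec_injective_of_isUnit ((Matrix.isUnit_iff_isUnit_det g).mpr hg)

theorem finrank_map_mulVecLin {g : Matrix (Fin n) (Fin n) ℂ} (hg : IsUnit g.det)
    (U : Submodule ℂ (Fin n → ℂ)) :
    Module.finrank ℂ (U.map g.mulVecLin) = Module.finrank ℂ U :=
  (Submodule.equivMapOfInjective _ (mulVecLin_injective_of_isUnit_det hg) U).finrank_eq.symm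

/-- The translate of a partial flag by an invertible matrix. -/
def translate (E : PartialFlag a n) (g : Matrix (Fin n) (Fin n) ℂ) (hg : IsUnit g.det) :
    PartialFlag a n where
  space i := (E.space i).map g.mulVecLin
  mono _ _ hij := Submodule.map_mono (E.mono hij)
  finrank_eq i := (finrank_map_mulVecLin hg _).trans (E.finrank_eq i)

theorem stabilizerAlgebra_le_preimageTangent {X : Set (PartialFlag a n)} {E : PartialFlag a n}
    (hE : E ∈ X) : E.stabilizerAlgebra ≤ preimageTangent X E := by
  intro A hA
  refine mem_preimageTangent_of_line fun ε hε => ⟨hε, E, hE, fun i => ?_⟩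
  symm
  apply Submodule.eq_of_le_of_finrank_eq
  · rintro _ ⟨v, hv, rfl⟩
    have h1 := (E.space i).add_mem hv ((E.space i).smul_mem ε (hA i v hv))
    simpa [Matrix.add_mulVec, Matrix.smul_mulVec] using h1
  · exact finrank_map_mulVecLin hε _

/-- The codimension of the Zariski tangent space can be computed in the matrix algebra. -/
theorem finrank_quotient_map_mkQ {E : PartialFlag a n}
    {W : Submodule ℂ (Matrix (Fin n) (Fin n) ℂ)} (hW : E.stabilizerAlgebra ≤ W) :
    Module.finrank ℂ (E.TangentSpace ⧸ W.map E.stabilizerAlgebra.mkQ) =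
      Module.finrank ℂ (Matrix (Fin n) (Fin n) ℂ ⧸ W) :=
  (Submodule.quotientQuotientEquivQuotient _ _ hW).finrank_eq

theorem iInf_map_mkQ {ι : Type*} {E : PartialFlag a n}
    {W : ι → Submodule ℂ (Matrix (Fin n) (Fin n) ℂ)} (hW : ∀ i, E.stabilizerAlgebra ≤ W i) :
    ⨅ i, (W i).map E.stabilizerAlgebra.mkQ = (⨅ i, W i).map E.stabilizerAlgebra.mkQ := by
  have hinj := Submodule.comap_injective_of_surjective E.stabilizerAlgebra.mkQ_surjective
  apply hinj
  have key : ∀ U : Submodule ℂ (Matrix (Fin n) (Fin n) ℂ), E.stabilizerAlgebra ≤ U →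
      (U.map E.stabilizerAlgebra.mkQ).comap E.stabilizerAlgebra.mkQ = U := fun U hU => by
    rw [Submodule.comap_map_mkQ, sup_eq_right.mpr hU]
  rw [Submodule.comap_iInf, key _ (le_iInf hW)]
  exact iInf_congr fun i => key _ (hW i)

end PartialFlag

/-! ### Coordinate subspaces and matrix entries in a basis -/

section CoordSpan

variable {ι V : Type*} [AddCommGroup V] [Module ℂ V]

/-- The span of the basis vectors with index in `S`. -/
def coordSpan (b : Module.Basis ι ℂ V) (S : Finset ι) : Submodule ℂ V :=
  Submodule.span ℂ (b '' S)

theorem mem_coordSpan {b : Module.Basis ι ℂ V} {S : Finset ι} {v : V} :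
    v ∈ coordSpan b S ↔ ∀ i ∉ S, b.repr v i = 0 := by
  rw [coordSpan, Module.Basis.mem_span_image]
  simp only [Set.subset_def, SetLike.mem_coe, Finsupp.mem_support_iff]
  exact forall_congr' fun i => not_imp_comm

theorem basis_mem_coordSpan (b : Module.Basis ι ℂ V) {S : Finset ι} {i : ι} (hi : i ∈ S) :
    b i ∈ coordSpan b S :=
  Submodule.subset_span ⟨i, hi, rfl⟩

theorem coordSpan_le_iff {b : Module.Basis ι ℂ V} {S : Finset ι} {U : Submodule ℂ V} :
    coordSpan b S ≤ U ↔ ∀ i ∈ S, b i ∈ U := by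
  rw [coordSpan, Submodule.span_le]
  simp [Set.subset_def]

theorem finrank_coordSpan (b : Module.Basis ι ℂ V) (S : Finset ι) :
    Module.finrank ℂ (coordSpan b S) = S.card := by
  classical
  have h := finrank_span_finset_eq_card (R := ℂ) (s := S.image b) (by
    have := b.linearIndependent.linearIndepOn_id.mono (t := b '' (S : Set ι))
      (Set.image_subset_range _ _)
    simpa using this)
  rw [Finset.card_image_of_injective _ b.injective] at h
  rwa [Finset.coe_image] at h

theorem coordSpan_mono (b : Module.Basis ι ℂ V) {S T : Finset ι} (h : S ⊆ T) :
    coordSpan b S ≤ coordSpan b T :=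
  Submodule.span_mono (Set.image_mono (by exact_mod_cast h))

theorem coordSpan_inf [DecidableEq ι] (b : Module.Basis ι ℂ V) (S T : Finset ι) :
    coordSpan b S ⊓ coordSpan b T = coordSpan b (S ∩ T) := by
  ext v
  simp only [Submodule.mem_inf, mem_coordSpan, Finset.mem_inter, not_and_or]
  exact ⟨fun h i hi => hi.elim (h.1 i) (h.2 i),
    fun h => ⟨fun i hi => h i (Or.inl hi), fun i hi => h i (Or.inr hi)⟩⟩

end CoordSpan

section MatrixEntries

variable {ι : Type*} {n : ℕ}

/-- The matrices whose entries in the positions `S`, taken with respect to the basis `b`,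
vanish. -/
def vanishingEntries (b : Module.Basis ι ℂ (Fin n → ℂ)) (S : Finset (ι × ι)) :
    Submodule ℂ (Matrix (Fin n) (Fin n) ℂ) where
  carrier := {A | ∀ p ∈ S, b.repr (A *ᵥ b p.2) p.1 = 0}
  zero_mem' := by simp
  add_mem' hA hB p hp := by simp [add_mulVec, hA p hp, hB p hp]
  smul_mem' c A hA p hp := by simp [smul_mulVec, hA p hp]

theorem mem_vanishingEntries {b : Module.Basis ι ℂ (Fin n → ℂ)} {S : Finset (ι × ι)}
    {A : Matrix (Fin n) (Fin n) ℂ} :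
    A ∈ vanishingEntries b S ↔ ∀ p ∈ S, b.repr (A *ᵥ b p.2) p.1 = 0 :=
  Iff.rfl

theorem exists_matrix_entries [Fintype ι] (b : Module.Basis ι ℂ (Fin n → ℂ))
    (z : ι → ι → ℂ) :
    ∃ A : Matrix (Fin n) (Fin n) ℂ, ∀ r c, b.repr (A *ᵥ b c) r = z r c := by
  refine ⟨LinearMap.toMatrix' (b.constr ℂ fun c => b.equivFun.symm fun r => z r c), fun r c => ?_⟩
  rw [← Matrix.toLin'_apply, Matrix.toLin'_toMatrix', Module.Basis.constr_basis,
    ← Module.Basis.equivFun_apply, LinearEquiv.apply_symm_apply]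

theorem finrank_quotient_vanishingEntries [Fintype ι] [DecidableEq ι]
    (b : Module.Basis ι ℂ (Fin n → ℂ)) (S : Finset (ι × ι)) :
    Module.finrank ℂ (Matrix (Fin n) (Fin n) ℂ ⧸ vanishingEntries b S) = S.card := by
  let L : Matrix (Fin n) (Fin n) ℂ →ₗ[ℂ] (S → ℂ) :=
    { toFun := fun A p => b.repr (A *ᵥ b p.1.2) p.1.1
      map_add' := fun A B => by ext p; simp [add_mulVec]
      map_smul' := fun c A => by ext p; simp [smul_mulVec] }
  have hker : L.ker = vanishingEntries b S := by
    ext A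
    rw [LinearMap.mem_ker, mem_vanishingEntries, funext_iff]
    exact ⟨fun h p hp => h ⟨p, hp⟩, fun h p => h p.1 p.2⟩
  have hsurj : Function.Surjective L := fun z => by
    obtain ⟨A, hA⟩ := exists_matrix_entries b
      (fun r c => if h : (r, c) ∈ S then z ⟨(r, c), h⟩ else 0)
    exact ⟨A, funext fun p => by simp [L, hA]⟩
  rw [← hker, (L.quotKerEquivOfSurjective hsurj).finrank_eq]
  simp

theorem mulVec_mem_coordSpan_iff {b : Module.Basis ι ℂ (Fin n → ℂ)} {S T : Finset ι}
    {A : Matrix (Fin n) (Fin n) ℂ} :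
    (∀ v ∈ coordSpan b S, A *ᵥ v ∈ coordSpan b T) ↔
      ∀ c ∈ S, ∀ r ∉ T, b.repr (A *ᵥ b c) r = 0 := by
  constructor
  · exact fun h c hc => mem_coordSpan.mp (h _ (basis_mem_coordSpan b hc))
  · intro h
    have : coordSpan b S ≤ (coordSpan b T).comap A.mulVecLin :=
      coordSpan_le_iff.mpr fun c hc => mem_coordSpan.mpr (h c hc)
    exact this

end MatrixEntries

/-! ### The Schubert variety of `142536` -/

/-- A complete flag of `ℂⁿ`. -/
structure IsCompleteFlag {n : ℕ} (F : ℕ → Submodule ℂ (Fin n → ℂ)) : Prop where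
  mono : Monotone F
  finrank_eq : ∀ j ≤ n, Module.finrank ℂ (F j) = j

/-- The essential conditions on `X_{142536}`: all others follow by counting dimensions. -/
theorem mem_schubertVariety_iff {F : ℕ → Submodule ℂ (Fin 6 → ℂ)} (hF : IsCompleteFlag F)
    (E : PartialFlag ![2, 4] 6) :
    E ∈ schubertVariety ![2, 4] perm142536 F ↔
      1 ≤ Module.finrank ℂ ↥(E.space 0 ⊓ F 3) ∧ 2 ≤ Module.finrank ℂ ↥(E.space 1 ⊓ F 3) := by
  constructor
  · intro h
    exact ⟨le_trans (by decide) (h 0 3 (by decide)), le_trans (by decide) (h 1 3 (by decide))⟩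
  · rintro ⟨h0, h1⟩ i j hj
    obtain ⟨hj1, hj6⟩ := Finset.mem_Icc.mp hj
    have mono : ∀ {U W : Submodule ℂ (Fin 6 → ℂ)}, U ≤ W →
        Module.finrank ℂ U ≤ Module.finrank ℂ W := fun h => Submodule.finrank_mono h
    have generic : ∀ i, (![2, 4] : Fin 2 → ℕ) i + j ≤
        6 + Module.finrank ℂ ↥(E.space i ⊓ F j) := fun i => by
      have h := Submodule.finrank_sup_add_finrank_inf_eq (E.space i) (F j)
      have h' := Submodule.finrank_le (E.space i ⊔ F j)
      rw [E.finrank_eq, hF.finrank_eq j hj6] at h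
      simp at h'
      omega
    have h3 : ∀ i, 3 ≤ j → Module.finrank ℂ ↥(E.space i ⊓ F 3) ≤
        Module.finrank ℂ ↥(E.space i ⊓ F j) :=
      fun i h => mono (inf_le_inf_left _ (hF.mono h))
    have hline : j = 2 → 1 ≤ Module.finrank ℂ ↥(E.space 1 ⊓ F j) := by
      rintro rfl
      have h := Submodule.finrank_sup_add_finrank_inf_eq (E.space 1 ⊓ F 3) (F 2)
      have h' : Module.finrank ℂ ↥((E.space 1 ⊓ F 3) ⊔ F 2) ≤ 3 :=
        (mono (sup_le inf_le_right (hF.mono (by norm_num)))).trans_eq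
          (hF.finrank_eq 3 (by norm_num))
      have h'' : Module.finrank ℂ ↥((E.space 1 ⊓ F 3) ⊓ F 2) ≤
          Module.finrank ℂ ↥(E.space 1 ⊓ F 2) := mono (inf_le_inf_right _ inf_le_left)
      rw [hF.finrank_eq 2 (by norm_num)] at h
      omega
    have g0 := generic 0
    have g1 := generic 1
    have k0 := h3 0
    have k1 := h3 1
    have rank0 : ∀ j ∈ Finset.Icc 1 6, rankFn perm142536 2 j =
        if j < 3 then 0 else if j < 6 then 1 else 2 := by decide
    have rank1 : ∀ j ∈ Finset.Icc 1 6, rankFn perm142536 4 j =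
        if j < 2 then 0 else if j < 3 then 1 else if j < 5 then 2 else j - 2 := by decide
    fin_cases i
    · change rankFn perm142536 2 j ≤ Module.finrank ℂ ↥(E.space 0 ⊓ F j)
      rw [rank0 j hj]
      simp at g0
      split_ifs <;> omega
    · change rankFn perm142536 4 j ≤ Module.finrank ℂ ↥(E.space 1 ⊓ F j)
      rw [rank1 j hj]
      simp at g1
      split_ifs <;> omega

/-! ### Tangent spaces in an adapted basis -/

/-- The index set `s ⊕ s` of the blocks with label in `s`: block `k` is spanned by the basis
vectors `inl k` and `inr k`. -/
def blockIndices (s : Finset (Fin 3)) : Finset (Fin 3 ⊕ Fin 3) := s.disjSum s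

/-- The indices of the first vectors of all blocks. -/
def leftIndices : Finset (Fin 3 ⊕ Fin 3) := Finset.univ.disjSum ∅

/-- The positions of the entries that vanish on the stabilizer of the flag formed by block `j`
and the sum of the blocks `j` and `k`. -/
def stabilizerEntries (j k : Fin 3) : Finset ((Fin 3 ⊕ Fin 3) × (Fin 3 ⊕ Fin 3)) :=
  Finset.univ.filter fun p =>
    (p.2 ∈ blockIndices {j} ∧ p.1 ∉ blockIndices {j}) ∨
      (p.2 ∈ blockIndices {j, k} ∧ p.1 ∉ blockIndices {j, k})

/-- The positions of the entries that vanish on the tangent space of the Schubert variety. With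
`E` the flag of blocks and `F` the span of the left vectors, these express that `A` maps
`E_i ∩ F` into `E_i + F`. -/
def tangentEntries (j k : Fin 3) : Finset ((Fin 3 ⊕ Fin 3) × (Fin 3 ⊕ Fin 3)) :=
  Finset.univ.filter fun p =>
    p.2 ∈ leftIndices ∧ p.1 ∉ leftIndices ∧ p ∈ stabilizerEntries j k

theorem card_stabilizerEntries {j k : Fin 3} (hjk : j ≠ k) :
    (stabilizerEntries j k).card = 12 := by
  revert j k; decide

theorem card_tangentEntries {j k : Fin 3} (hjk : j ≠ k) : (tangentEntries j k).card = 3 := by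
  revert j k; decide

theorem exists_ne_zero_of_one_le_finrank {V : Type*} [AddCommGroup V] [Module ℂ V]
    {U : Submodule ℂ V} (h : 1 ≤ Module.finrank ℂ U) : ∃ v ∈ U, v ≠ 0 := by
  refine U.exists_mem_ne_zero_of_ne_bot ?_
  rintro rfl
  simp at h

theorem image_pair_eq_blockIndices (j : Fin 3) :
    Finset.univ.image (![Sum.inl j, Sum.inr j] : Fin 2 → Fin 3 ⊕ Fin 3) = blockIndices {j} := by
  revert j; decide

theorem image_triple_subset_blockIndices (j k : Fin 3) :
    Finset.univ.image (![Sum.inr j, Sum.inr k, Sum.inl k] : Fin 3 → Fin 3 ⊕ Fin 3) ⊆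
      blockIndices {j, k} := by
  revert j k; decide

theorem card_image_triple {j k : Fin 3} (hjk : j ≠ k) :
    (Finset.univ.image
      (![Sum.inr j, Sum.inr k, Sum.inl k] : Fin 3 → Fin 3 ⊕ Fin 3)).card = 3 := by
  revert j k; decide

theorem map_inf_comap_eq {V : Type*} [AddCommGroup V] [Module ℂ V] (f : V →ₗ[ℂ] V)
    (U W : Submodule ℂ V) : (U ⊓ W.comap f).map f = U.map f ⊓ W := by
  ext v
  constructor
  · rintro ⟨u, ⟨hu, hw⟩, rfl⟩
    exact ⟨⟨u, hu, rfl⟩, hw⟩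
  · rintro ⟨⟨u, hu, rfl⟩, hw⟩
    exact ⟨u, ⟨hu, hw⟩, rfl⟩

namespace PartialFlag

variable {E : PartialFlag ![2, 4] 6} {b : Module.Basis (Fin 3 ⊕ Fin 3) ℂ (Fin 6 → ℂ)}
  {j k : Fin 3}

theorem stabilizerAlgebra_eq_vanishingEntries (h0 : E.space 0 = coordSpan b (blockIndices {j}))
    (h1 : E.space 1 = coordSpan b (blockIndices {j, k})) :
    E.stabilizerAlgebra = vanishingEntries b (stabilizerEntries j k) := by
  ext A
  change (∀ i, ∀ v ∈ E.space i, A *ᵥ v ∈ E.space i) ↔ _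
  rw [Fin.forall_fin_two, h0, h1, mulVec_mem_coordSpan_iff, mulVec_mem_coordSpan_iff,
    mem_vanishingEntries]
  constructor
  · rintro ⟨hj, hk⟩ p hp
    rcases (Finset.mem_filter.mp hp).2 with ⟨hc, hr⟩ | ⟨hc, hr⟩
    · exact hj _ hc _ hr
    · exact hk _ hc _ hr
  · intro h
    exact ⟨fun c hc r hr => h (r, c) (Finset.mem_filter.mpr ⟨Finset.mem_univ _, Or.inl ⟨hc, hr⟩⟩),
      fun c hc r hr => h (r, c) (Finset.mem_filter.mpr ⟨Finset.mem_univ _, Or.inr ⟨hc, hr⟩⟩)⟩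

/-- A square minor of the matrix of `g` vanishes if its rows cut out a subspace containing the
image under `g` of a nonzero combination of the basis vectors of its columns. -/
theorem minor_eq_zero {ι : Type*} [Fintype ι] [DecidableEq ι] {n m : ℕ}
    (b : Module.Basis ι ℂ (Fin n → ℂ))
    {g : Matrix (Fin n) (Fin n) ℂ} (r c : Fin m → ι) (hc : Function.Injective c)
    {w : Fin n → ℂ} (hw : w ≠ 0) (hwc : w ∈ coordSpan b (Finset.univ.image c))
    (hr : ∀ i, b.repr (g *ᵥ w) (r i) = 0) :
    (Matrix.of fun i i' => b.coord (r i) (g *ᵥ b (c i'))).det = 0 := by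
  have hsum : w = ∑ i', b.repr w (c i') • b (c i') := by
    conv_lhs => rw [← b.sum_repr w]
    rw [← Finset.sum_image (f := fun i => b.repr w i • b i) (fun x _ y _ h => hc h)]
    symm
    refine Finset.sum_subset (Finset.subset_univ _) fun i _ hi => ?_
    rw [mem_coordSpan.mp hwc i hi, zero_smul]
  rw [← Matrix.exists_mulVec_eq_zero_iff]
  refine ⟨fun i' => b.repr w (c i'), fun h => hw ?_, funext fun i => ?_⟩
  · rw [hsum]
    exact Finset.sum_eq_zero fun i' _ => by rw [show b.repr w (c i') = 0 from congrFun h i',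
      zero_smul]
  · have h := hr i
    have hg : g *ᵥ w = ∑ i', b.repr w (c i') • (g *ᵥ b (c i')) := by
      conv_lhs => rw [hsum]
      rw [← Matrix.mulVecLin_apply, map_sum]
      simp
    rw [hg, ← Module.Basis.coord_apply, map_sum] at h
    simp only [map_smul, smul_eq_mul] at h
    rw [Pi.zero_apply, ← h]
    simp only [mulVec, dotProduct, of_apply]
    exact Finset.sum_congr rfl fun i' _ => mul_comm _ _

theorem differentialAtOne_minor_eq_zero {X : Set (PartialFlag ![2, 4] 6)}
    {A : Matrix (Fin 6) (Fin 6) ℂ} (hA : A ∈ preimageTangent X E) {m : ℕ}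
    (r c : Fin m → Fin 3 ⊕ Fin 3)
    (h : ∀ g ∈ orbitPreimage X E,
      (Matrix.of fun i i' => b.coord (r i) (g *ᵥ b (c i'))).det = 0) :
    differentialAtOne A
      (Matrix.of fun i i' => matrixCoeff (b.coord (r i)) (b (c i'))).det = 0 := by
  apply hA
  intro g hg
  rw [RingHom.map_det, ← h g hg]
  congr 1
  ext i i'
  simp [eval_matrixCoeff]

variable {F : ℕ → Submodule ℂ (Fin 6 → ℂ)}

/-- The part of a matrix in the tangent space that maps `F` into itself is tangent to the orbit
of the stabilizer of `F`; what remains stabilizes `E`. -/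
theorem vanishingEntries_le_preimageTangent (hF : IsCompleteFlag F)
    (hF3 : F 3 = coordSpan b leftIndices)
    (h0 : E.space 0 = coordSpan b (blockIndices {j}))
    (h1 : E.space 1 = coordSpan b (blockIndices {j, k}))
    (hE : E ∈ schubertVariety ![2, 4] perm142536 F) :
    vanishingEntries b (tangentEntries j k) ≤
      preimageTangent (schubertVariety ![2, 4] perm142536 F) E := by
  intro A hA
  obtain ⟨B, hB⟩ := exists_matrix_entries b
    (fun r c => if c ∈ leftIndices ∧ r ∉ leftIndices then 0 else b.repr (A *ᵥ b c) r)
  have hBF : ∀ v ∈ F 3, B *ᵥ v ∈ F 3 := by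
    rw [hF3, mulVec_mem_coordSpan_iff]
    intro c hc r hr
    rw [hB, if_pos ⟨hc, hr⟩]
  have hstab : A - B ∈ E.stabilizerAlgebra := by
    rw [stabilizerAlgebra_eq_vanishingEntries h0 h1]
    intro p hp
    rw [Matrix.sub_mulVec, map_sub, Finsupp.sub_apply, hB]
    split_ifs with h
    · rw [sub_zero]
      exact hA p (Finset.mem_filter.mpr ⟨Finset.mem_univ _, h.1, h.2, hp⟩)
    · exact sub_self _
  have hBt : B ∈ preimageTangent (schubertVariety ![2, 4] perm142536 F) E := by
    refine mem_preimageTangent_of_line fun ε hε =>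
      ⟨hε, E.translate (1 + ε • B) hε, ?_, fun _ => rfl⟩
    rw [mem_schubertVariety_iff hF] at hE ⊢
    have key : ∀ i, Module.finrank ℂ ↥(E.space i ⊓ F 3) ≤
        Module.finrank ℂ ↥((E.translate (1 + ε • B) hε).space i ⊓ F 3) := fun i => by
      rw [← finrank_map_mulVecLin hε]
      apply Submodule.finrank_mono
      rintro _ ⟨v, ⟨hvE, hvF⟩, rfl⟩
      refine ⟨⟨v, hvE, rfl⟩, ?_⟩
      have := (F 3).add_mem hvF ((F 3).smul_mem ε (hBF v hvF))
      simpa [Matrix.add_mulVec, Matrix.smul_mulVec] using this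
    exact ⟨hE.1.trans (key 0), hE.2.trans (key 1)⟩
  have := Submodule.add_mem _ (stabilizerAlgebra_le_preimageTangent hE hstab) hBt
  rwa [sub_add_cancel] at this

theorem mem_coordSpan_leftIndices {v : Fin 6 → ℂ} :
    v ∈ coordSpan b leftIndices ↔ ∀ m, b.repr v (Sum.inr m) = 0 := by
  rw [mem_coordSpan]
  simp [leftIndices]

/-- The vanishing on the preimage of the Schubert variety of suitable minors of sizes `2` and `3`
gives the linear conditions on the tangent space. -/
theorem preimageTangent_le_vanishingEntries (hF : IsCompleteFlag F)
    (hF3 : F 3 = coordSpan b leftIndices)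
    (h0 : E.space 0 = coordSpan b (blockIndices {j}))
    (h1 : E.space 1 = coordSpan b (blockIndices {j, k})) (hjk : j ≠ k) :
    preimageTangent (schubertVariety ![2, 4] perm142536 F) E ≤
      vanishingEntries b (tangentEntries j k) := by
  intro A hA
  have hrow : ∀ m, m ≠ j → b.repr (A *ᵥ b (Sum.inl j)) (Sum.inr m) = 0 := by
    intro m hm
    have h := differentialAtOne_minor_eq_zero (b := b) hA ![Sum.inr j, Sum.inr m]
      ![Sum.inl j, Sum.inr j] (fun g hg => by
        obtain ⟨hgu, E', hE', hmap⟩ := hg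
        obtain ⟨u, ⟨huE, huF⟩, hu0⟩ := exists_ne_zero_of_one_le_finrank
          ((mem_schubertVariety_iff hF E').mp hE').1
        rw [hmap 0] at huE
        obtain ⟨w, hw, rfl⟩ := huE
        rw [SetLike.mem_coe, hF3, mem_coordSpan_leftIndices] at huF
        refine minor_eq_zero b _ _ ?_ (w := w) ?_ ?_ ?_
        · intro x y; fin_cases x <;> fin_cases y <;> simp
        · rintro rfl; simp at hu0
        · rw [SetLike.mem_coe, h0] at hw
          rwa [image_pair_eq_blockIndices]
        · intro i; fin_cases i
          · exact huF j
          · exact huF m)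
    rw [det_fin_two] at h
    simpa [differentialAtOne_sub, differentialAtOne_mul, eval_one_matrixCoeff,
      differentialAtOne_matrixCoeff, Finsupp.single_apply, hm, hm.symm] using h
  have hrow' : ∀ m, m ≠ j → m ≠ k → b.repr (A *ᵥ b (Sum.inl k)) (Sum.inr m) = 0 := by
    intro m hmj hmk
    have h := differentialAtOne_minor_eq_zero (b := b) hA ![Sum.inr j, Sum.inr k, Sum.inr m]
      ![Sum.inr j, Sum.inr k, Sum.inl k] (fun g hg => by
        obtain ⟨hgu, E', hE', hmap⟩ := hg
        have hdim := ((mem_schubertVariety_iff hF E').mp hE').2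
        -- The preimage of `E'₄ ∩ F₃` has dimension at least two in `E₄`, so it meets the
        -- hyperplane of `E₄` spanned by the three columns of the minor.
        have hK : E'.space 1 ⊓ F 3 =
            (E.space 1 ⊓ (F 3).comap g.mulVecLin).map g.mulVecLin := by
          rw [hmap 1, map_inf_comap_eq]
        rw [hK, finrank_map_mulVecLin hgu] at hdim
        set C : Finset (Fin 3 ⊕ Fin 3) :=
          Finset.univ.image ![Sum.inr j, Sum.inr k, Sum.inl k] with hC
        have hCsub : C ⊆ blockIndices {j, k} := image_triple_subset_blockIndices j k
        have hCcard : C.card = 3 := card_image_triple hjk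
        have hsum := Submodule.finrank_sup_add_finrank_inf_eq
          (E.space 1 ⊓ (F 3).comap g.mulVecLin) (coordSpan b C)
        have hle : Module.finrank ℂ
            ↥((E.space 1 ⊓ (F 3).comap g.mulVecLin) ⊔ coordSpan b C) ≤ 4 := by
          refine (Submodule.finrank_mono (sup_le inf_le_left ?_)).trans_eq (E.finrank_eq 1)
          rw [h1]
          exact coordSpan_mono b hCsub
        rw [finrank_coordSpan, hCcard] at hsum
        obtain ⟨w, ⟨⟨hwE, hwF⟩, hwC⟩, hw0⟩ := exists_ne_zero_of_one_le_finrank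
          (U := (E.space 1 ⊓ (F 3).comap g.mulVecLin) ⊓ coordSpan b C) (by omega)
        rw [SetLike.mem_coe, Submodule.mem_comap, hF3, mem_coordSpan_leftIndices] at hwF
        refine minor_eq_zero b _ _ ?_ hw0 hwC ?_
        · intro x y; fin_cases x <;> fin_cases y <;> simp [hjk, hjk.symm]
        · intro i; fin_cases i
          · exact hwF j
          · exact hwF k
          · exact hwF m)
    rw [det_fin_three] at h
    simpa [differentialAtOne_sub, differentialAtOne_add, differentialAtOne_mul,
      eval_one_matrixCoeff, differentialAtOne_matrixCoeff, Finsupp.single_apply, hmj, hmj.symm,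
      hmk, hmk.symm, hjk, hjk.symm] using h
  intro p hp
  obtain ⟨r, c⟩ := p
  have hp' := (Finset.mem_filter.mp hp).2
  obtain ⟨hc, hr, hs⟩ := hp'
  have hs' := (Finset.mem_filter.mp hs).2
  rcases c with c | c
  · rcases r with r | r
    · simp [leftIndices] at hr
    · simp only [blockIndices, Finset.inl_mem_disjSum, Finset.inr_mem_disjSum,
        Finset.mem_singleton, Finset.mem_insert, not_or] at hs'
      rcases hs' with ⟨rfl, h⟩ | ⟨rfl | rfl, h, h'⟩
      · exact hrow r h
      · exact hrow r h
      · exact hrow' r h h'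
  · simp [leftIndices] at hc

theorem preimageTangent_eq_vanishingEntries (hF : IsCompleteFlag F)
    (hF3 : F 3 = coordSpan b leftIndices)
    (h0 : E.space 0 = coordSpan b (blockIndices {j}))
    (h1 : E.space 1 = coordSpan b (blockIndices {j, k})) (hjk : j ≠ k)
    (hE : E ∈ schubertVariety ![2, 4] perm142536 F) :
    preimageTangent (schubertVariety ![2, 4] perm142536 F) E =
      vanishingEntries b (tangentEntries j k) :=
  le_antisymm (preimageTangent_le_vanishingEntries hF hF3 h0 h1 hjk)
    (vanishingEntries_le_preimageTangent hF hF3 h0 h1 hE)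

end PartialFlag

/-! ### Four subspaces in normal form -/

/-- Four three-dimensional subspaces in normal form: in the coordinates `(x, y) ∈ ℂ³ × ℂ³` with
respect to `b`, they are `y = 0`, `x = 0`, `y = x` and `y = κ x`, where `κ` is a diagonal matrix
with distinct entries. -/
structure IsNormalForm (b : Module.Basis (Fin 3 ⊕ Fin 3) ℂ (Fin 6 → ℂ)) (κ : Fin 3 → ℂ)
    (W : Fin 4 → Submodule ℂ (Fin 6 → ℂ)) : Prop where
  injective : Function.Injective κ
  mem_zero : ∀ v, v ∈ W 0 ↔ ∀ m, b.repr v (Sum.inr m) = 0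
  mem_one : ∀ v, v ∈ W 1 ↔ ∀ m, b.repr v (Sum.inl m) = 0
  mem_two : ∀ v, v ∈ W 2 ↔ ∀ m, b.repr v (Sum.inr m) = b.repr v (Sum.inl m)
  mem_three : ∀ v, v ∈ W 3 ↔ ∀ m, b.repr v (Sum.inr m) = κ m * b.repr v (Sum.inl m)

theorem mem_coordSpan_blockIndices {b : Module.Basis (Fin 3 ⊕ Fin 3) ℂ (Fin 6 → ℂ)}
    {s : Finset (Fin 3)} {v : Fin 6 → ℂ} :
    v ∈ coordSpan b (blockIndices s) ↔
      ∀ m ∉ s, b.repr v (Sum.inl m) = 0 ∧ b.repr v (Sum.inr m) = 0 := by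
  rw [mem_coordSpan]
  constructor
  · exact fun h m hm => ⟨h _ (by simpa [blockIndices] using hm),
      h _ (by simpa [blockIndices] using hm)⟩
  · rintro h (m | m) hm
    · exact (h m (by simpa [blockIndices] using hm)).1
    · exact (h m (by simpa [blockIndices] using hm)).2

theorem card_blockIndices (s : Finset (Fin 3)) : (blockIndices s).card = 2 * s.card := by
  rw [blockIndices, Finset.card_disjSum, two_mul]

/-- The basis with coordinates `(x, y - c x)`. -/
def shearBasis (b : Module.Basis (Fin 3 ⊕ Fin 3) ℂ (Fin 6 → ℂ)) (c : Fin 3 → ℂ) :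
    Module.Basis (Fin 3 ⊕ Fin 3) ℂ (Fin 6 → ℂ) :=
  Module.Basis.ofEquivFun
    { toFun := fun v => Sum.elim (fun m => b.equivFun v (Sum.inl m))
        (fun m => b.equivFun v (Sum.inr m) - c m * b.equivFun v (Sum.inl m))
      invFun := fun w => b.equivFun.symm (Sum.elim (fun m => w (Sum.inl m))
        (fun m => w (Sum.inr m) + c m * w (Sum.inl m)))
      map_add' := fun v w => by
        ext (m | m)
        · simp
        · simp; ring
      map_smul' := fun a v => by
        ext (m | m)
        · simp
        · simp; ring
      left_inv := fun v => by
        apply b.equivFun.injective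
        rw [LinearEquiv.apply_symm_apply]
        ext (m | m) <;> simp
      right_inv := fun w => by
        simp only [LinearEquiv.apply_symm_apply]
        ext (m | m) <;> simp }

theorem shearBasis_repr_inl (b : Module.Basis (Fin 3 ⊕ Fin 3) ℂ (Fin 6 → ℂ)) (c : Fin 3 → ℂ)
    (v : Fin 6 → ℂ) (m : Fin 3) :
    (shearBasis b c).repr v (Sum.inl m) = b.repr v (Sum.inl m) := rfl

theorem shearBasis_repr_inr (b : Module.Basis (Fin 3 ⊕ Fin 3) ℂ (Fin 6 → ℂ)) (c : Fin 3 → ℂ)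
    (v : Fin 6 → ℂ) (m : Fin 3) :
    (shearBasis b c).repr v (Sum.inr m) =
      b.repr v (Sum.inr m) - c m * b.repr v (Sum.inl m) := rfl

namespace IsNormalForm

variable {b : Module.Basis (Fin 3 ⊕ Fin 3) ℂ (Fin 6 → ℂ)} {κ : Fin 3 → ℂ}
  {W : Fin 4 → Submodule ℂ (Fin 6 → ℂ)}

/-- Each of the four subspaces is a coordinate subspace of a basis with the same blocks. -/
theorem exists_adapted_basis (hW : IsNormalForm b κ W) (i : Fin 4) :
    ∃ b' : Module.Basis (Fin 3 ⊕ Fin 3) ℂ (Fin 6 → ℂ), W i = coordSpan b' leftIndices ∧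
      ∀ s, coordSpan b (blockIndices s) = coordSpan b' (blockIndices s) := by
  have shear : ∀ c : Fin 3 → ℂ,
      (∀ v, v ∈ W i ↔ ∀ m, b.repr v (Sum.inr m) = c m * b.repr v (Sum.inl m)) →
      ∃ b' : Module.Basis (Fin 3 ⊕ Fin 3) ℂ (Fin 6 → ℂ), W i = coordSpan b' leftIndices ∧
        ∀ s, coordSpan b (blockIndices s) = coordSpan b' (blockIndices s) := by
    intro c hc
    refine ⟨shearBasis b c, ?_, fun s => ?_⟩
    · ext v
      simp only [hc, PartialFlag.mem_coordSpan_leftIndices, shearBasis_repr_inr, sub_eq_zero]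
    · ext v
      simp only [mem_coordSpan_blockIndices, shearBasis_repr_inl, shearBasis_repr_inr]
      refine forall₂_congr fun m _ => and_congr_right fun h => ?_
      rw [h, mul_zero, sub_zero]
  fin_cases i
  · exact shear 0 fun v => by simpa using hW.mem_zero v
  · refine ⟨b.reindex (Equiv.sumComm _ _), ?_, fun s => ?_⟩
    · ext v
      rw [PartialFlag.mem_coordSpan_leftIndices]
      simp only [Module.Basis.repr_reindex_apply]
      exact hW.mem_one v
    · ext v
      simp only [mem_coordSpan_blockIndices, Module.Basis.repr_reindex_apply]
      exact forall₂_congr fun m _ => and_comm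
  · exact shear 1 fun v => by simpa using hW.mem_two v
  · exact shear κ fun v => hW.mem_three v

theorem eq_zero_of_coords {v : Fin 6 → ℂ} (h : ∀ m, b.repr v (Sum.inl m) = 0)
    (h' : ∀ m, b.repr v (Sum.inr m) = 0) : v = 0 := by
  apply b.repr.injective
  ext (m | m)
  · simpa using h m
  · simpa using h' m

/-- The planes meeting all four subspaces are the three blocks: such a plane is spanned by some
`(x, 0)` and `(0, x)` because it meets the first three subspaces, and then `x` is an eigenvector
of `κ` because it meets the fourth. -/
theorem exists_eq_block (hW : IsNormalForm b κ W) {U : Submodule ℂ (Fin 6 → ℂ)}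
    (hU : Module.finrank ℂ U = 2) (hUW : ∀ i, 1 ≤ Module.finrank ℂ ↥(U ⊓ W i)) :
    ∃ j, U = coordSpan b (blockIndices {j}) := by
  -- `u 0 = (x, 0)` and `u 1 = (0, y)` span `U`; the vectors `u 2` and `u 3` give the relations
  -- `β y = α x` and `δ y = γ κ x`.
  choose u hu hu0 using fun i => exists_ne_zero_of_one_le_finrank (hUW i)
  have h0 := (hW.mem_zero _).mp (hu 0).2
  have h1 := (hW.mem_one _).mp (hu 1).2
  have h2 := (hW.mem_two _).mp (hu 2).2
  have h3 := (hW.mem_three _).mp (hu 3).2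
  have hx : ∃ j, b.repr (u 0) (Sum.inl j) ≠ 0 := by
    by_contra! h
    exact hu0 0 (eq_zero_of_coords h h0)
  have hy : ∃ j, b.repr (u 1) (Sum.inr j) ≠ 0 := by
    by_contra! h
    exact hu0 1 (eq_zero_of_coords h1 h)
  have hli : LinearIndependent ℂ ![u 0, u 1] := by
    rw [LinearIndependent.pair_iff]
    intro α β h
    constructor
    · obtain ⟨j, hj⟩ := hx
      have := congrArg (fun v => b.repr v (Sum.inl j)) h
      simpa [h1, hj] using this
    · obtain ⟨j, hj⟩ := hy
      have := congrArg (fun v => b.repr v (Sum.inr j)) h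
      simpa [h0, hj] using this
  have hspan : Submodule.span ℂ {u 0, u 1} = U := by
    apply Submodule.eq_of_le_of_finrank_eq
    · rw [Submodule.span_le, Set.insert_subset_iff, Set.singleton_subset_iff]
      exact ⟨(hu 0).1, (hu 1).1⟩
    · have := finrank_span_eq_card hli
      rw [hU]
      rwa [Matrix.range_cons_cons_empty] at this
  obtain ⟨α, β, h2'⟩ := Submodule.mem_span_pair.mp (hspan ▸ (hu 2).1)
  obtain ⟨γ, δ, h3'⟩ := Submodule.mem_span_pair.mp (hspan ▸ (hu 3).1)
  have e2 : ∀ m, β * b.repr (u 1) (Sum.inr m) = α * b.repr (u 0) (Sum.inl m) := fun m => by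
    have := h2 m
    rw [← h2'] at this
    simpa [h0, h1] using this
  have e3 : ∀ m, δ * b.repr (u 1) (Sum.inr m) = κ m * (γ * b.repr (u 0) (Sum.inl m)) := fun m => by
    have := h3 m
    rw [← h3'] at this
    simpa [h0, h1] using this
  obtain ⟨j, hj⟩ := hx
  have hβ : β ≠ 0 := by
    rintro rfl
    have hα : α = 0 := by simpa [hj] using (e2 j).symm
    exact hu0 2 (by rw [← h2', hα]; simp)
  have hγ : γ ≠ 0 := by
    rintro rfl
    obtain ⟨l, hl⟩ := hy
    have hδ : δ = 0 := by simpa [hl] using e3 l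
    exact hu0 3 (by rw [← h3', hδ]; simp)
  have hκ : ∀ m, b.repr (u 0) (Sum.inl m) ≠ 0 → δ * α = κ m * (β * γ) := fun m hm => by
    apply mul_right_cancel₀ hm
    linear_combination β * e3 m - δ * e2 m
  have hxm : ∀ m, m ≠ j → b.repr (u 0) (Sum.inl m) = 0 := by
    intro m hm
    by_contra h
    exact hm (hW.injective (mul_right_cancel₀ (mul_ne_zero hβ hγ) ((hκ m h).symm.trans (hκ j hj))))
  have hym : ∀ m, m ≠ j → b.repr (u 1) (Sum.inr m) = 0 := by
    intro m hm
    have := e2 m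
    rw [hxm m hm, mul_zero] at this
    exact (mul_eq_zero.mp this).resolve_left hβ
  refine ⟨j, Submodule.eq_of_le_of_finrank_eq ?_ ?_⟩
  · rw [← hspan, Submodule.span_le, Set.insert_subset_iff, Set.singleton_subset_iff]
    constructor
    · exact mem_coordSpan_blockIndices.mpr fun m hm => ⟨hxm m (by simpa using hm), h0 m⟩
    · exact mem_coordSpan_blockIndices.mpr fun m hm => ⟨h1 m, hym m (by simpa using hm)⟩
  · rw [hU, finrank_coordSpan, card_blockIndices]
    simp

theorem exists_ne_zero_of_two_le_finrank {V : Type*} [AddCommGroup V] [Module ℂ V]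
    [FiniteDimensional ℂ V] {P : Submodule ℂ V} (h : 2 ≤ Module.finrank ℂ P) (φ : V →ₗ[ℂ] ℂ) :
    ∃ v ∈ P, v ≠ 0 ∧ φ v = 0 := by
  have hker : (φ.comp P.subtype).ker ≠ ⊥ :=
    LinearMap.ker_ne_bot_of_finrank_lt (by rw [Module.finrank_self]; omega)
  obtain ⟨v, hv, hv0⟩ := Submodule.exists_mem_ne_zero_of_ne_bot hker
  exact ⟨v, v.2, fun h => hv0 (Subtype.ext h), hv⟩

/-- In a plane on which `φ` does not vanish, the kernel of `φ` is a line. -/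
theorem exists_eq_smul_of_finrank_eq_two {V : Type*} [AddCommGroup V] [Module ℂ V]
    [FiniteDimensional ℂ V] {P : Submodule ℂ V} (h : Module.finrank ℂ P = 2) (φ : V →ₗ[ℂ] ℂ)
    {e p q : V} (he : e ∈ P) (hφe : φ e ≠ 0) (hp : p ∈ P) (hφp : φ p = 0) (hp0 : p ≠ 0)
    (hq : q ∈ P) (hφq : φ q = 0) : ∃ c : ℂ, q = c • p := by
  have hlt : Module.finrank ℂ ↥(P ⊓ φ.ker) < 2 := by
    rw [← h]
    apply Submodule.finrank_lt_finrank_of_lt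
    exact lt_of_le_of_ne inf_le_left fun h' => hφe (h'.symm ▸ he : e ∈ P ⊓ φ.ker).2
  obtain ⟨v, hv⟩ := finrank_le_one_iff.mp (Nat.lt_succ_iff.mp hlt)
  obtain ⟨c, hc⟩ := hv ⟨p, hp, hφp⟩
  obtain ⟨d, hd⟩ := hv ⟨q, hq, hφq⟩
  have hc' : c • (v : V) = p := congrArg Subtype.val hc
  have hd' : d • (v : V) = q := congrArg Subtype.val hd
  have hc0 : c ≠ 0 := by
    rintro rfl
    exact hp0 (by rw [← hc', zero_smul])
  exact ⟨d * c⁻¹, by rw [← hc', ← hd', smul_smul, mul_assoc, inv_mul_cancel₀ hc0, mul_one]⟩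

/-- The four-dimensional subspaces containing a block and meeting all four subspaces in planes
are the sums of two blocks: such a subspace is `A × A` for a plane `A` that is invariant
under `κ`. -/
theorem exists_eq_two_blocks (hW : IsNormalForm b κ W) {U : Submodule ℂ (Fin 6 → ℂ)}
    (hU : Module.finrank ℂ U = 4) (hUW : ∀ i, 2 ≤ Module.finrank ℂ ↥(U ⊓ W i)) {j : Fin 3}
    (hj : coordSpan b (blockIndices {j}) ≤ U) :
    ∃ k, j ≠ k ∧ U = coordSpan b (blockIndices {j, k}) := by
  have hinf : (U ⊓ W 0) ⊓ (U ⊓ W 1) = ⊥ := by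
    rw [eq_bot_iff]
    rintro v ⟨⟨-, h0⟩, -, h1⟩
    exact eq_zero_of_coords ((hW.mem_one v).mp h1) ((hW.mem_zero v).mp h0)
  have hsum := Submodule.finrank_sup_add_finrank_inf_eq (U ⊓ W 0) (U ⊓ W 1)
  rw [hinf, finrank_bot, add_zero] at hsum
  have hle : (U ⊓ W 0) ⊔ (U ⊓ W 1) ≤ U := sup_le inf_le_left inf_le_left
  have hle' := Submodule.finrank_mono hle
  have d0 := hUW 0
  have d1 := hUW 1
  have hsup : (U ⊓ W 0) ⊔ (U ⊓ W 1) = U := Submodule.eq_of_le_of_finrank_eq hle (by omega)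
  have hbl : b (Sum.inl j) ∈ U ⊓ W 0 :=
    ⟨hj (basis_mem_coordSpan b (by simp [blockIndices])), (hW.mem_zero _).mpr (by simp)⟩
  have hbr : b (Sum.inr j) ∈ U ⊓ W 1 :=
    ⟨hj (basis_mem_coordSpan b (by simp [blockIndices])), (hW.mem_one _).mpr (by simp)⟩
  -- Choose `v = p + q = (x, x)` and `v' = p' + q' = (x', κ x')` in `U` with `x_j = x'_j = 0`. Both
  -- planes `U ∩ W 0` and `U ∩ W 1` have only one direction with vanishing `j`-th coordinate, so
  -- `x'` and `κ x'` are multiples of `x`.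
  obtain ⟨v, ⟨hvU, hv⟩, hv0, hvj⟩ :=
    exists_ne_zero_of_two_le_finrank (hUW 2) (b.coord (Sum.inl j))
  obtain ⟨v', ⟨hvU', hv'⟩, hv0', hvj'⟩ :=
    exists_ne_zero_of_two_le_finrank (hUW 3) (b.coord (Sum.inl j))
  rw [Module.Basis.coord_apply] at hvj hvj'
  obtain ⟨p, hp, q, hq, rfl⟩ := Submodule.mem_sup.mp (hsup.symm ▸ hvU : v ∈ (U ⊓ W 0) ⊔ (U ⊓ W 1))
  obtain ⟨p', hp', q', hq', rfl⟩ :=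
    Submodule.mem_sup.mp (hsup.symm ▸ hvU' : v' ∈ (U ⊓ W 0) ⊔ (U ⊓ W 1))
  have hpy := (hW.mem_zero _).mp hp.2
  have hqx := (hW.mem_one _).mp hq.2
  have hpy' := (hW.mem_zero _).mp hp'.2
  have hqx' := (hW.mem_one _).mp hq'.2
  have e2 : ∀ m, b.repr q (Sum.inr m) = b.repr p (Sum.inl m) := by
    simpa [hpy, hqx] using (hW.mem_two _).mp hv
  have e3 : ∀ m, b.repr q' (Sum.inr m) = κ m * b.repr p' (Sum.inl m) := by
    simpa [hpy', hqx'] using (hW.mem_three _).mp hv'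
  have hpj : b.repr p (Sum.inl j) = 0 := by simpa [hqx] using hvj
  have hpj' : b.repr p' (Sum.inl j) = 0 := by simpa [hqx'] using hvj'
  have hp0 : p ≠ 0 := by
    rintro rfl
    have : q = 0 := eq_zero_of_coords hqx (fun m => by simpa using e2 m)
    exact hv0 (by simp [this])
  have hq0 : q ≠ 0 := by
    rintro rfl
    exact hp0 (eq_zero_of_coords (fun m => by simpa using (e2 m).symm) hpy)
  obtain ⟨c, rfl⟩ := exists_eq_smul_of_finrank_eq_two (P := U ⊓ W 0) (by omega)
    (b.coord (Sum.inl j)) hbl (by simp) hp hpj hp0 hp' hpj'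
  obtain ⟨d, rfl⟩ := exists_eq_smul_of_finrank_eq_two (P := U ⊓ W 1) (by omega)
    (b.coord (Sum.inr j)) hbr (by simp) hq (by simpa [e2] using hpj) hq0 hq'
    (by rw [Module.Basis.coord_apply, e3 j, hpj', mul_zero])
  have e3' : ∀ m, d * b.repr p (Sum.inl m) = κ m * (c * b.repr p (Sum.inl m)) := fun m => by
    simpa [e2] using e3 m
  obtain ⟨k, hk⟩ : ∃ k, b.repr p (Sum.inl k) ≠ 0 := by
    by_contra! h
    exact hp0 (eq_zero_of_coords h hpy)
  have hc : c ≠ 0 := by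
    rintro rfl
    have hd : d = 0 := by simpa [hk] using e3' k
    exact hv0' (by simp [hd])
  have hxm : ∀ m, m ≠ k → b.repr p (Sum.inl m) = 0 := by
    intro m hm
    by_contra h
    apply hm
    apply hW.injective
    apply mul_right_cancel₀ hc
    apply mul_right_cancel₀ (mul_ne_zero h hk)
    linear_combination b.repr p (Sum.inl m) * e3' k - b.repr p (Sum.inl k) * e3' m
  have hjk : j ≠ k := by
    rintro rfl
    exact hk hpj
  have hpk : p = b.repr p (Sum.inl k) • b (Sum.inl k) := by
    apply b.repr.injective
    ext (m | m)
    · rcases eq_or_ne m k with rfl | hm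
      · simp
      · simp [hxm m hm, hm.symm]
    · simp [hpy]
  have hqk : q = b.repr p (Sum.inl k) • b (Sum.inr k) := by
    apply b.repr.injective
    ext (m | m)
    · simp [hqx]
    · rcases eq_or_ne m k with rfl | hm
      · simp [e2]
      · simp [e2, hxm m hm, hm.symm]
  have hkl : b (Sum.inl k) ∈ U := (U.smul_mem_iff hk).mp (hpk ▸ hp.1)
  have hkr : b (Sum.inr k) ∈ U := (U.smul_mem_iff hk).mp (hqk ▸ hq.1)
  refine ⟨k, hjk, (Submodule.eq_of_le_of_finrank_eq ?_ ?_).symm⟩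
  · rw [coordSpan_le_iff]
    rintro (m | m) hm
    · simp only [blockIndices, Finset.inl_mem_disjSum, Finset.mem_insert,
        Finset.mem_singleton] at hm
      rcases hm with rfl | rfl
      exacts [hbl.1, hkl]
    · simp only [blockIndices, Finset.inr_mem_disjSum, Finset.mem_insert,
        Finset.mem_singleton] at hm
      rcases hm with rfl | rfl
      exacts [hbr.1, hkr]
  · rw [hU, finrank_coordSpan, card_blockIndices, Finset.card_pair hjk]

end IsNormalForm

/-! ### The six flags -/

/-- The flag formed by block `p.1` and the sum of the blocks `p.1` and `p.2`. -/
def blockFlag (b : Module.Basis (Fin 3 ⊕ Fin 3) ℂ (Fin 6 → ℂ))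
    (p : {p : Fin 3 × Fin 3 // p.1 ≠ p.2}) : PartialFlag ![2, 4] 6 where
  space := ![coordSpan b (blockIndices {p.1.1}), coordSpan b (blockIndices {p.1.1, p.1.2})]
  mono := by
    intro i i' h
    have hle : coordSpan b (blockIndices {p.1.1}) ≤ coordSpan b (blockIndices {p.1.1, p.1.2}) :=
      coordSpan_mono b (Finset.disjSum_mono (by simp) (by simp))
    fin_cases i <;> fin_cases i'
    · exact le_rfl
    · exact hle
    · exact absurd h (by decide)
    · exact le_rfl
  finrank_eq i := by
    fin_cases i
    · change Module.finrank ℂ (coordSpan b (blockIndices {p.1.1})) = 2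
      rw [finrank_coordSpan, card_blockIndices, Finset.card_singleton]
    · change Module.finrank ℂ (coordSpan b (blockIndices {p.1.1, p.1.2})) = 4
      rw [finrank_coordSpan, card_blockIndices, Finset.card_pair p.2]

theorem blockFlag_injective (b : Module.Basis (Fin 3 ⊕ Fin 3) ℂ (Fin 6 → ℂ)) :
    Function.Injective (blockFlag b) := by
  have mem : ∀ s m, b (Sum.inl m) ∈ coordSpan b (blockIndices s) ↔ m ∈ s := fun s m => by
    refine ⟨fun h => ?_, fun h => basis_mem_coordSpan b (by simpa [blockIndices] using h)⟩
    by_contra hm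
    simpa using (mem_coordSpan_blockIndices.mp h m hm).1
  intro p q h
  have h0 : coordSpan b (blockIndices {p.1.1}) = coordSpan b (blockIndices {q.1.1}) :=
    congrArg (fun E => E.space 0) h
  have h1 : coordSpan b (blockIndices {p.1.1, p.1.2}) =
      coordSpan b (blockIndices {q.1.1, q.1.2}) := congrArg (fun E => E.space 1) h
  have e0 : p.1.1 = q.1.1 := by
    have := (mem {q.1.1} p.1.1).mp (h0 ▸ (mem _ _).mpr (by simp))
    simpa using this
  have e1 : p.1.2 = q.1.2 := by
    have := (mem {q.1.1, q.1.2} p.1.2).mp (h1 ▸ (mem _ _).mpr (by simp))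
    rw [Finset.mem_insert, Finset.mem_singleton] at this
    exact this.resolve_left fun h' => p.2 (e0.trans h'.symm)
  exact Subtype.ext (Prod.ext e0 e1)

/-- A subspace spanned by complexifications of real vectors is the complexification of their
real span. -/
theorem span_complex_eq {n : ℕ} (T : Set (Fin n → ℝ)) :
    Submodule.span ℂ ((fun (v : Fin n → ℝ) (m : Fin n) => (v m : ℂ)) '' T) =
      Submodule.span ℂ ((fun (v : Fin n → ℝ) (m : Fin n) => (v m : ℂ)) ''
        (Submodule.span ℝ T : Submodule ℝ (Fin n → ℝ))) := by
  apply le_antisymm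
  · exact Submodule.span_mono (Set.image_mono Submodule.subset_span)
  · rw [Submodule.span_le]
    rintro _ ⟨v, hv, rfl⟩
    have h : Submodule.span ℝ T ≤ ((Submodule.span ℂ
        ((fun (v : Fin n → ℝ) (m : Fin n) => (v m : ℂ)) '' T)).restrictScalars ℝ).comap
          (Complex.ofRealCLM.toLinearMap.compLeft (Fin n)) :=
      Submodule.span_le.mpr fun u hu => Submodule.subset_span ⟨u, hu, rfl⟩
    exact h hv

theorem blockFlag_isReal {b : Module.Basis (Fin 3 ⊕ Fin 3) ℂ (Fin 6 → ℂ)}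
    (hb : ∀ i, ∃ r : Fin 6 → ℝ, b i = fun m => (r m : ℂ))
    (p : {p : Fin 3 × Fin 3 // p.1 ≠ p.2}) : (blockFlag b p).IsReal := by
  choose r hr using hb
  have key : ∀ S : Finset (Fin 3 ⊕ Fin 3), ∃ W : Submodule ℝ (Fin 6 → ℝ), coordSpan b S =
      Submodule.span ℂ ((fun (v : Fin 6 → ℝ) (m : Fin 6) => (v m : ℂ)) '' W) := fun S => by
    refine ⟨Submodule.span ℝ (r '' S), ?_⟩
    rw [← span_complex_eq, coordSpan, Set.image_image]
    exact congrArg _ (Set.image_congr fun i _ => hr i)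
  intro i
  fin_cases i
  · exact key _
  · exact key _

namespace IsNormalForm

variable {b : Module.Basis (Fin 3 ⊕ Fin 3) ℂ (Fin 6 → ℂ)} {κ : Fin 3 → ℂ}
  {F : Fin 4 → ℕ → Submodule ℂ (Fin 6 → ℂ)}

theorem blockFlag_mem_schubertVariety (hW : IsNormalForm b κ fun i => F i 3)
    (hF : ∀ i, IsCompleteFlag (F i)) (p : {p : Fin 3 × Fin 3 // p.1 ≠ p.2}) (i : Fin 4) :
    blockFlag b p ∈ schubertVariety ![2, 4] perm142536 (F i) := by
  obtain ⟨b', h3, hb'⟩ := hW.exists_adapted_basis i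
  have key : ∀ s, Module.finrank ℂ ↥(coordSpan b (blockIndices s) ⊓ F i 3) = s.card := fun s => by
    rw [show F i 3 = _ from h3, hb' s, coordSpan_inf, finrank_coordSpan]
    revert s; decide
  rw [mem_schubertVariety_iff (hF i)]
  constructor
  · change 1 ≤ Module.finrank ℂ ↥(coordSpan b (blockIndices {p.1.1}) ⊓ F i 3)
    rw [key, Finset.card_singleton]
  · change 2 ≤ Module.finrank ℂ ↥(coordSpan b (blockIndices {p.1.1, p.1.2}) ⊓ F i 3)
    rw [key, Finset.card_pair p.2]

theorem iInter_schubertVariety_eq_range (hW : IsNormalForm b κ fun i => F i 3)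
    (hF : ∀ i, IsCompleteFlag (F i)) :
    ⋂ i, schubertVariety ![2, 4] perm142536 (F i) = Set.range (blockFlag b) := by
  apply Set.Subset.antisymm
  · intro E hE
    have hE' := fun i => (mem_schubertVariety_iff (hF i) E).mp (Set.mem_iInter.mp hE i)
    obtain ⟨j, hj⟩ := hW.exists_eq_block (E.finrank_eq 0) fun i => (hE' i).1
    obtain ⟨k, hjk, hk⟩ := hW.exists_eq_two_blocks (E.finrank_eq 1) (fun i => (hE' i).2)
      (hj ▸ E.mono (by decide : (0 : Fin 2) ≤ 1))
    refine ⟨⟨(j, k), hjk⟩, PartialFlag.ext (funext fun i => ?_)⟩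
    fin_cases i
    · exact hj.symm
    · exact hk.symm
  · rintro _ ⟨p, rfl⟩
    exact Set.mem_iInter.mpr fun i => hW.blockFlag_mem_schubertVariety hF p i

/-- A matrix `A` that maps `U ∩ F₃` into `U + F₃` for all four flags, where `U` is the sum of the
blocks in `s`, has no component from a block inside `s` to a block outside: the first three
conditions make such a component a multiple `c` of the identity of `ℂ²`, and the fourth gives
`c κ_j = c κ_m`. -/
theorem component_eq_zero (hW : IsNormalForm b κ fun i => F i 3)
    {A : Matrix (Fin 6) (Fin 6) ℂ} {s : Finset (Fin 3)}
    (hA : ∀ i, ∀ v ∈ coordSpan b (blockIndices s) ⊓ F i 3,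
      A *ᵥ v ∈ coordSpan b (blockIndices s) ⊔ F i 3)
    {j m : Fin 3} (hj : j ∈ s) (hm : m ∉ s) :
    (b.repr (A *ᵥ b (Sum.inl j)) (Sum.inl m) = 0 ∧ b.repr (A *ᵥ b (Sum.inl j)) (Sum.inr m) = 0) ∧
      b.repr (A *ᵥ b (Sum.inr j)) (Sum.inl m) = 0 ∧
        b.repr (A *ᵥ b (Sum.inr j)) (Sum.inr m) = 0 := by
  have hl : b (Sum.inl j) ∈ coordSpan b (blockIndices s) :=
    basis_mem_coordSpan b (by simpa [blockIndices] using hj)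
  have hr : b (Sum.inr j) ∈ coordSpan b (blockIndices s) :=
    basis_mem_coordSpan b (by simpa [blockIndices] using hj)
  have split : ∀ i, ∀ u ∈ coordSpan b (blockIndices s) ⊔ F i 3, ∃ w ∈ F i 3,
      b.repr u (Sum.inl m) = b.repr w (Sum.inl m) ∧
        b.repr u (Sum.inr m) = b.repr w (Sum.inr m) := fun i u hu => by
    obtain ⟨v, hv, w, hw, rfl⟩ := Submodule.mem_sup.mp hu
    have := mem_coordSpan_blockIndices.mp hv m hm
    exact ⟨w, hw, by simp [this.1], by simp [this.2]⟩
  obtain ⟨w0, hw0, hx0, hy0⟩ := split 0 _ (hA 0 (b (Sum.inl j)) ⟨hl, (hW.mem_zero _).mpr (by simp)⟩)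
  obtain ⟨w1, hw1, hx1, hy1⟩ := split 1 _ (hA 1 (b (Sum.inr j)) ⟨hr, (hW.mem_one _).mpr (by simp)⟩)
  obtain ⟨w2, hw2, hx2, hy2⟩ := split 2 _ (hA 2 (b (Sum.inl j) + b (Sum.inr j))
    ⟨Submodule.add_mem _ hl hr, (hW.mem_two _).mpr fun l => by
      simp [Finsupp.single_apply]⟩)
  obtain ⟨w3, hw3, hx3, hy3⟩ := split 3 _ (hA 3 (b (Sum.inl j) + κ j • b (Sum.inr j))
    ⟨Submodule.add_mem _ hl (Submodule.smul_mem _ _ hr), (hW.mem_three _).mpr fun l => by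
      rcases eq_or_ne j l with rfl | h
      · simp
      · simp [h]⟩)
  rw [(hW.mem_zero _).mp hw0 m] at hy0
  rw [(hW.mem_one _).mp hw1 m] at hx1
  rw [(hW.mem_two _).mp hw2 m, ← hx2] at hy2
  rw [(hW.mem_three _).mp hw3 m, ← hx3] at hy3
  simp only [mulVec_add, mulVec_smul, map_add, map_smul, Finsupp.add_apply, Finsupp.smul_apply,
    smul_eq_mul, hy0, hx1, zero_add, add_zero, mul_zero] at hy2 hy3
  have hne : κ j - κ m ≠ 0 := sub_ne_zero.mpr fun h => hm (hW.injective h ▸ hj)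
  have hx0' : b.repr (A *ᵥ b (Sum.inl j)) (Sum.inl m) = 0 := by
    apply (mul_eq_zero.mp _).resolve_left hne
    linear_combination hy3 - κ j * hy2
  exact ⟨⟨hx0', hy0⟩, hx1, hy2.trans hx0'⟩

theorem blockFlag_transverseAt (hW : IsNormalForm b κ fun i => F i 3)
    (hF : ∀ i, IsCompleteFlag (F i)) (p : {p : Fin 3 × Fin 3 // p.1 ≠ p.2}) :
    (blockFlag b p).TransverseAt (fun _ : Fin 4 => perm142536) F := by
  obtain ⟨⟨j, k⟩, hjk⟩ := p
  set E := blockFlag b ⟨(j, k), hjk⟩ with hE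
  have hEX : ∀ i, E ∈ schubertVariety ![2, 4] perm142536 (F i) :=
    hW.blockFlag_mem_schubertVariety hF _
  have h0 : E.space 0 = coordSpan b (blockIndices {j}) := rfl
  have h1 : E.space 1 = coordSpan b (blockIndices {j, k}) := rfl
  choose b' h3 hb' using hW.exists_adapted_basis
  have htan : ∀ i, PartialFlag.preimageTangent (schubertVariety ![2, 4] perm142536 (F i)) E =
      vanishingEntries (b' i) (tangentEntries j k) := fun i =>
    PartialFlag.preimageTangent_eq_vanishingEntries (hF i) (h3 i) (h0.trans (hb' i _))
      (h1.trans (hb' i _)) hjk (hEX i)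
  have hstab : ∀ i, E.stabilizerAlgebra ≤
      PartialFlag.preimageTangent (schubertVariety ![2, 4] perm142536 (F i)) E := fun i =>
    PartialFlag.stabilizerAlgebra_le_preimageTangent (hEX i)
  have hcodim : ∀ i, Module.finrank ℂ (E.TangentSpace ⧸
      PartialFlag.zariskiTangent (schubertVariety ![2, 4] perm142536 (F i)) E) = 3 := fun i => by
    rw [PartialFlag.zariskiTangent, PartialFlag.finrank_quotient_map_mkQ (hstab i), htan i,
      finrank_quotient_vanishingEntries, card_tangentEntries hjk]
  have hinf : ⨅ i, PartialFlag.preimageTangent (schubertVariety ![2, 4] perm142536 (F i)) E =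
      E.stabilizerAlgebra := by
    refine le_antisymm (fun A hA => ?_) (le_iInf hstab)
    rw [Submodule.mem_iInf] at hA
    have hmap : ∀ s, (∀ c ∈ blockIndices s, ∀ r ∉ blockIndices s, (r, c) ∈ stabilizerEntries j k) →
        ∀ i, ∀ v ∈ coordSpan b (blockIndices s) ⊓ F i 3,
          A *ᵥ v ∈ coordSpan b (blockIndices s) ⊔ F i 3 := by
      intro s hs i
      rw [hb' i s, show F i 3 = _ from h3 i, coordSpan_inf]
      have hAi := htan i ▸ hA i
      have : ∀ v ∈ coordSpan (b' i) (blockIndices s ∩ leftIndices),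
          A *ᵥ v ∈ coordSpan (b' i) (blockIndices s ∪ leftIndices) := by
        rw [mulVec_mem_coordSpan_iff]
        intro c hc r hr
        rw [Finset.mem_inter] at hc
        rw [Finset.mem_union, not_or] at hr
        exact hAi (r, c) (Finset.mem_filter.mpr
          ⟨Finset.mem_univ _, hc.2, hr.2, hs c hc.1 r hr.1⟩)
      refine fun v hv => coordSpan_le_iff.mpr (fun c hc => ?_) (this v hv)
      rcases Finset.mem_union.mp hc with h | h
      · exact Submodule.mem_sup_left (basis_mem_coordSpan _ h)
      · exact Submodule.mem_sup_right (basis_mem_coordSpan _ h)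
    have hzero : ∀ s, (∀ c ∈ blockIndices s, ∀ r ∉ blockIndices s,
        (r, c) ∈ stabilizerEntries j k) →
        ∀ v ∈ coordSpan b (blockIndices s), A *ᵥ v ∈ coordSpan b (blockIndices s) := by
      intro s hs
      rw [mulVec_mem_coordSpan_iff]
      rintro (c | c) hc (r | r) hr <;>
        simp only [blockIndices, Finset.inl_mem_disjSum, Finset.inr_mem_disjSum] at hc hr
      · exact (hW.component_eq_zero (hmap s hs) hc hr).1.1
      · exact (hW.component_eq_zero (hmap s hs) hc hr).1.2
      · exact (hW.component_eq_zero (hmap s hs) hc hr).2.1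
      · exact (hW.component_eq_zero (hmap s hs) hc hr).2.2
    change ∀ i, ∀ v ∈ E.space i, A *ᵥ v ∈ E.space i
    rw [Fin.forall_fin_two, h0, h1]
    exact ⟨hzero _ fun c hc r hr => Finset.mem_filter.mpr ⟨Finset.mem_univ _, Or.inl ⟨hc, hr⟩⟩,
      hzero _ fun c hc r hr => Finset.mem_filter.mpr ⟨Finset.mem_univ _, Or.inr ⟨hc, hr⟩⟩⟩
  have hbot : ⨅ i, PartialFlag.zariskiTangent (schubertVariety ![2, 4] perm142536 (F i)) E =
      E.stabilizerAlgebra.map E.stabilizerAlgebra.mkQ :=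
    (PartialFlag.iInf_map_mkQ hstab).trans (by rw [hinf])
  have hdim : Module.finrank ℂ (E.TangentSpace ⧸
      ⨅ i, PartialFlag.zariskiTangent (schubertVariety ![2, 4] perm142536 (F i)) E) = 12 := by
    rw [(Submodule.quotEquivOfEq _ _ hbot).finrank_eq, PartialFlag.finrank_quotient_map_mkQ le_rfl,
      PartialFlag.stabilizerAlgebra_eq_vanishingEntries h0 h1, finrank_quotient_vanishingEntries,
      card_stabilizerEntries hjk]
  have hlength : permLength perm142536 = 3 := by decide
  refine ⟨fun i => (hcodim i).trans hlength.symm, hdim.trans ?_⟩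
  rw [Finset.sum_congr rfl fun i _ => hcodim i]
  simp

end IsNormalForm

end

noncomputable section

open Polynomial

/-! ### Binary quintics and the osculating flags -/

/-- The isomorphism from quintic forms to `ℂ⁶` that takes `(t X + 1)⁵` to the point `γ(t)` of the
rational normal curve. Forms are dehomogenized: they are polynomials in one variable of degree at
most five. -/
def quinticVec : ℂ[X] →ₗ[ℂ] (Fin 6 → ℂ) where
  toFun f m := f.coeff (5 - m) / (Nat.choose 5 m : ℂ)
  map_add' f g := by ext m; simp [add_div]
  map_smul' c f := by ext m; simp [mul_div_assoc]

theorem quinticVec_apply (f : ℂ[X]) (m : Fin 6) :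
    quinticVec f m = f.coeff (5 - m) / (Nat.choose 5 m : ℂ) := rfl

theorem quinticVec_monomial (m : Fin 6) :
    quinticVec (C (Nat.choose 5 m : ℂ) * X ^ (5 - (m : ℕ))) = Pi.single m 1 := by
  ext i
  rw [quinticVec_apply, coeff_C_mul, coeff_X_pow]
  rcases eq_or_ne i m with rfl | h
  · have : (Nat.choose 5 i : ℂ) ≠ 0 := by
      exact_mod_cast (Nat.choose_pos (by omega)).ne'
    simp [this]
  · have : ¬ (5 - (i : ℕ) = 5 - (m : ℕ)) := fun h' => h (Fin.ext (by omega))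
    simp [this, h]

theorem quinticVec_sum (v : Fin 6 → ℂ) :
    quinticVec (∑ m : Fin 6, C (v m) * (C (Nat.choose 5 m : ℂ) * X ^ (5 - (m : ℕ)))) = v := by
  rw [map_sum]
  conv_rhs => rw [pi_eq_sum_univ' v]
  refine Finset.sum_congr rfl fun m _ => ?_
  rw [← smul_eq_C_mul, map_smul, quinticVec_monomial]

/-- Two polynomials of degree at most one form a basis of the space of linear forms. -/
structure IsLinearBasis (x y : ℂ[X]) : Prop where
  one_mem : ∃ a b : ℂ, 1 = C a * x + C b * y
  X_mem : ∃ a b : ℂ, X = C a * x + C b * y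

/-- The span of the monomials of degree `n` in `x` and `y`. -/
def formSpan (n : ℕ) (x y : ℂ[X]) : Submodule ℂ ℂ[X] :=
  Submodule.span ℂ (Set.range fun r : Fin (n + 1) => x ^ (n - (r : ℕ)) * y ^ (r : ℕ))

theorem mul_mem_formSpan {n : ℕ} {x y f : ℂ[X]} (hf : f ∈ formSpan n x y) (a b : ℂ) :
    (C a * x + C b * y) * f ∈ formSpan (n + 1) x y := by
  induction hf using Submodule.span_induction with
  | mem f hf =>
    obtain ⟨r, rfl⟩ := hf
    have hr : (r : ℕ) ≤ n := Nat.lt_succ_iff.mp r.2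
    have hx : x ^ (n + 1 - (r : ℕ)) * y ^ (r : ℕ) ∈ formSpan (n + 1) x y :=
      Submodule.subset_span ⟨r.castSucc, rfl⟩
    have hy : x ^ (n + 1 - ((r : ℕ) + 1)) * y ^ ((r : ℕ) + 1) ∈ formSpan (n + 1) x y :=
      Submodule.subset_span ⟨r.succ, rfl⟩
    convert Submodule.add_mem _ (Submodule.smul_mem _ a hx) (Submodule.smul_mem _ b hy) using 1
    rw [Nat.succ_sub hr, Nat.succ_eq_add_one, Nat.add_sub_add_right, smul_eq_C_mul, smul_eq_C_mul]
    ring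
  | zero => simp
  | add f g _ _ hf hg => rw [mul_add]; exact Submodule.add_mem _ hf hg
  | smul c f _ hf => rw [mul_smul_comm]; exact Submodule.smul_mem _ c hf

theorem X_pow_mem_formSpan {x y : ℂ[X]} (h : IsLinearBasis x y) {n k : ℕ} (hk : k ≤ n) :
    X ^ k ∈ formSpan n x y := by
  obtain ⟨a, b, h1⟩ := h.one_mem
  obtain ⟨c, d, hX⟩ := h.X_mem
  induction n generalizing k with
  | zero =>
    obtain rfl : k = 0 := by omega
    exact Submodule.subset_span ⟨0, by simp⟩
  | succ n ih =>
    rcases Nat.lt_or_ge n k with h' | h'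
    · obtain rfl : k = n + 1 := by omega
      have := mul_mem_formSpan (ih le_rfl) c d
      rwa [← hX, ← pow_succ'] at this
    · have := mul_mem_formSpan (ih h') a b
      rwa [← h1, one_mul] at this

theorem mem_formSpan_of_natDegree_le {x y f : ℂ[X]} (h : IsLinearBasis x y) {n : ℕ}
    (hf : f.natDegree ≤ n) : f ∈ formSpan n x y := by
  rw [f.as_sum_range_C_mul_X_pow]
  refine Submodule.sum_mem _ fun i hi => ?_
  rw [← smul_eq_C_mul]
  exact Submodule.smul_mem _ _ (X_pow_mem_formSpan h (by rw [Finset.mem_range] at hi; omega))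

/-- The basis of `ℂ⁶` that corresponds to the monomials of degree five in two independent linear
forms. -/
def monomialBasis {x y : ℂ[X]} (h : IsLinearBasis x y) : Module.Basis (Fin 6) ℂ (Fin 6 → ℂ) :=
  basisOfTopLeSpanOfCardEqFinrank
    (fun r : Fin 6 => quinticVec (x ^ (5 - (r : ℕ)) * y ^ (r : ℕ)))
    (by
      intro v _
      have hv := quinticVec_sum v
      rw [← hv]
      set f := ∑ m : Fin 6, C (v m) * (C (Nat.choose 5 m : ℂ) * X ^ (5 - (m : ℕ))) with hf
      have hmem : f ∈ formSpan 5 x y := by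
        refine Submodule.sum_mem _ fun m _ => ?_
        rw [← smul_eq_C_mul, ← smul_eq_C_mul]
        exact Submodule.smul_mem _ _ (Submodule.smul_mem _ _ (X_pow_mem_formSpan h (by omega)))
      have := Submodule.mem_map_of_mem (f := quinticVec) hmem
      rwa [formSpan, Submodule.map_span, ← Set.range_comp] at this)
    (by simp)

theorem monomialBasis_apply {x y : ℂ[X]} (h : IsLinearBasis x y) (r : Fin 6) :
    monomialBasis h r = quinticVec (x ^ (5 - (r : ℕ)) * y ^ (r : ℕ)) := by
  simp [monomialBasis]

theorem iteratedDeriv_pow_pi {n : ℕ} (e : Fin n → ℕ) (r : ℕ) :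
    iteratedDeriv r (fun (t : ℂ) (m : Fin n) => t ^ e m) =
      fun t m => ((e m).descFactorial r : ℂ) * t ^ (e m - r) := by
  induction r with
  | zero => simp
  | succ r ih =>
    rw [iteratedDeriv_succ, ih]
    ext t m
    rw [deriv_pi (fun m => by fun_prop)]
    simp only [deriv_const_mul_field', deriv_pow_field, Nat.descFactorial_succ, Nat.cast_mul,
      Nat.sub_sub]
    ring

/-- The coefficients of the linear form whose fifth power represents the point `t` of the
rational normal curve. -/
def formCoeffs : OnePoint ℝ → ℝ × ℝ
  | some t => (t, 1)
  | none => (1, 0)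

/-- The linear form whose fifth power represents the point `t` of the rational normal curve. -/
def pointForm (t : OnePoint ℝ) : ℂ[X] :=
  C ((formCoeffs t).1 : ℂ) * X + C ((formCoeffs t).2 : ℂ)

/-- A linear form independent of `pointForm t`. -/
def complementForm : OnePoint ℝ → ℂ[X]
  | some _ => X
  | none => 1

theorem pointForm_coe (t : ℝ) : pointForm (t : OnePoint ℝ) = C (t : ℂ) * X + 1 := by
  change C (t : ℂ) * X + C ((1 : ℝ) : ℂ) = _
  simp

theorem pointForm_infty : pointForm OnePoint.infty = X := by
  change C ((1 : ℝ) : ℂ) * X + C ((0 : ℝ) : ℂ) = _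
  simp

theorem complementForm_coe (t : ℝ) : complementForm (t : OnePoint ℝ) = X := rfl

theorem complementForm_infty : complementForm OnePoint.infty = 1 := rfl

theorem isLinearBasis_pointForm (t : OnePoint ℝ) :
    IsLinearBasis (pointForm t) (complementForm t) := by
  induction t using OnePoint.rec with
  | infty =>
    rw [pointForm_infty, complementForm_infty]
    exact ⟨⟨0, 1, by simp⟩, ⟨1, 0, by simp⟩⟩
  | coe t =>
    rw [pointForm_coe, complementForm_coe]
    exact ⟨⟨1, -t, by simp⟩, ⟨0, 1, by simp⟩⟩

theorem iteratedDeriv_normalCurve (t : ℝ) (r : Fin 6) :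
    iteratedDeriv r (normalCurve 6) (t : ℂ) = (Nat.descFactorial 5 r : ℂ) •
      monomialBasis (isLinearBasis_pointForm (t : OnePoint ℝ)) r := by
  have h : normalCurve 6 = fun (t : ℂ) (m : Fin 6) => t ^ (5 - (m : ℕ)) := rfl
  rw [h, iteratedDeriv_pow_pi, monomialBasis_apply, ← map_smul, pointForm_coe, complementForm_coe]
  refine (quinticVec_sum _).symm.trans (congrArg quinticVec ?_)
  rw [smul_eq_C_mul, map_natCast]
  fin_cases r <;> simp [Fin.sum_univ_six, Nat.descFactorial, Nat.choose] <;> ring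

theorem iteratedDeriv_normalCurveAtInfty (r : Fin 6) :
    iteratedDeriv r (normalCurveAtInfty 6) 0 = (Nat.descFactorial 5 r : ℂ) •
      monomialBasis (isLinearBasis_pointForm OnePoint.infty) r := by
  have h : normalCurveAtInfty 6 = fun (t : ℂ) (m : Fin 6) => t ^ (m : ℕ) := rfl
  rw [h, iteratedDeriv_pow_pi, monomialBasis_apply, ← map_smul, pointForm_infty,
    complementForm_infty]
  refine (quinticVec_sum _).symm.trans (congrArg quinticVec ?_)
  rw [smul_eq_C_mul, map_natCast]
  fin_cases r <;> simp [Fin.sum_univ_six, Nat.descFactorial, Nat.choose] <;> ring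

theorem span_smul_eq_coordSpan {V : Type*} [AddCommGroup V] [Module ℂ V]
    (b : Module.Basis (Fin 6) ℂ V) (u : ℕ → V)
    (hu : ∀ r : Fin 6, u r = (Nat.descFactorial 5 r : ℂ) • b r) {j : ℕ} (hj : j ≤ 6) :
    Submodule.span ℂ {v | ∃ r < j, v = u r} =
      coordSpan b (Finset.univ.filter fun r : Fin 6 => (r : ℕ) < j) := by
  apply le_antisymm
  · rw [Submodule.span_le]
    rintro _ ⟨r, hr, rfl⟩
    rw [hu ⟨r, by omega⟩]
    exact Submodule.smul_mem _ _ (basis_mem_coordSpan b (by simpa using hr))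
  · rw [coordSpan_le_iff]
    intro r hr
    have h0 : (Nat.descFactorial 5 r : ℂ) ≠ 0 := by
      rw [Nat.cast_ne_zero, ne_eq, Nat.descFactorial_eq_zero_iff_lt]
      omega
    rw [← Submodule.smul_mem_iff _ h0, ← hu r]
    exact Submodule.subset_span ⟨r, by simpa using hr, rfl⟩

theorem osculatingFlag_eq_coordSpan (t : OnePoint ℝ) {j : ℕ} (hj : j ≤ 6) :
    osculatingFlag 6 t j = coordSpan (monomialBasis (isLinearBasis_pointForm t))
      (Finset.univ.filter fun r : Fin 6 => (r : ℕ) < j) := by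
  induction t using OnePoint.rec with
  | infty => exact span_smul_eq_coordSpan _ _ iteratedDeriv_normalCurveAtInfty hj
  | coe t => exact span_smul_eq_coordSpan _ _ (iteratedDeriv_normalCurve t) hj

theorem isCompleteFlag_osculatingFlag (t : OnePoint ℝ) : IsCompleteFlag (osculatingFlag 6 t) where
  mono j j' h := by
    match t with
    | some t => exact Submodule.span_mono fun v ⟨r, hr, hv⟩ => ⟨r, hr.trans_le h, hv⟩
    | none => exact Submodule.span_mono fun v ⟨r, hr, hv⟩ => ⟨r, hr.trans_le h, hv⟩
  finrank_eq j hj := by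
    rw [osculatingFlag_eq_coordSpan t hj, finrank_coordSpan]
    revert j; decide

/-- The member `F₃(t)` consists of the multiples of the cube of the linear form of `t`. -/
theorem quinticVec_mem_osculatingFlag (t : OnePoint ℝ) {q : ℂ[X]} (hq : q.natDegree ≤ 2) :
    quinticVec (pointForm t ^ 3 * q) ∈ osculatingFlag 6 t 3 := by
  have h := mem_formSpan_of_natDegree_le (isLinearBasis_pointForm t) hq
  rw [osculatingFlag_eq_coordSpan t (by norm_num)]
  clear hq
  induction h using Submodule.span_induction with
  | mem f hf =>
    obtain ⟨r, rfl⟩ := hf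
    have hr := basis_mem_coordSpan (monomialBasis (isLinearBasis_pointForm t))
      (S := Finset.univ.filter fun r : Fin 6 => (r : ℕ) < 3) (i := ⟨r, by omega⟩) (by simp)
    rw [monomialBasis_apply] at hr
    rw [← mul_assoc, ← pow_add]
    have : 3 + (2 - (r : ℕ)) = 5 - r := by omega
    rwa [this]
  | zero => simp
  | add f g _ _ hf hg => rw [mul_add, map_add]; exact Submodule.add_mem _ hf hg
  | smul c f _ hf => rw [mul_smul_comm, map_smul]; exact Submodule.smul_mem _ c hf

/-! ### The eigenvalue problem -/

/-- The cubic whose roots are the eigenvalues of `l D⁻¹ R`, where `D = diag(1, l, l²)` and `R` is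
the matrix `involution` below. -/
def eigenCubic (l μ : ℝ) : ℝ :=
  l * μ ^ 3 - (6 * l ^ 2 - 8 * l + 3) * μ ^ 2 - (3 * l ^ 2 - 8 * l + 6) * μ + l

theorem continuous_eigenCubic (l : ℝ) : Continuous (eigenCubic l) := by
  unfold eigenCubic
  fun_prop

theorem exists_root_of_mul_neg {f : ℝ → ℝ} (hf : Continuous f) {a b : ℝ} (hab : a < b)
    (h : f a * f b < 0) : ∃ c, a < c ∧ c < b ∧ f c = 0 := by
  rcases mul_neg_iff.mp h with ⟨ha, hb⟩ | ⟨ha, hb⟩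
  · obtain ⟨c, hc, h0⟩ := intermediate_value_Ioo' hab.le hf.continuousOn ⟨hb, ha⟩
    exact ⟨c, hc.1, hc.2, h0⟩
  · obtain ⟨c, hc, h0⟩ := intermediate_value_Ioo hab.le hf.continuousOn ⟨ha, hb⟩
    exact ⟨c, hc.1, hc.2, h0⟩

/-- The cubic has three real roots with distinct squares. The squares matter because the
eigenvalues of the product of the two graph maps are, up to a common factor, the squares of the
roots. -/
theorem exists_roots_eigenCubic {l : ℝ} (h0 : l ≠ 0) (h1 : l ≠ 1) :
    ∃ μ : Fin 3 → ℝ, (∀ k, eigenCubic l (μ k) = 0) ∧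
      Function.Injective fun k => μ k ^ 2 := by
  have hc := continuous_eigenCubic l
  have hinj : ∀ a b c : ℝ, a ^ 2 ≠ b ^ 2 → a ^ 2 ≠ c ^ 2 → b ^ 2 ≠ c ^ 2 →
      Function.Injective fun k => (![a, b, c] : Fin 3 → ℝ) k ^ 2 := by
    intro a b c hab hac hbc i j h
    fin_cases i <;> fin_cases j <;> simp_all
  have hB : 0 < 6 * l ^ 2 - 8 * l + 3 := by nlinarith [sq_nonneg (3 * l - 2)]
  have hC : 0 < 3 * l ^ 2 - 8 * l + 6 := by nlinarith [sq_nonneg (3 * l - 4)]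
  have hl1 : 0 < (l - 1) ^ 2 := by
    have := sub_ne_zero.mpr h1
    positivity
  rcases lt_or_gt_of_ne h0 with hl | hl
  · -- The values at `-M`, `-2`, `-1/2` and `0` alternate in sign.
    have hL : 0 < -l := neg_pos.mpr hl
    set M := 3 + (6 * l ^ 2 - 8 * l + 3) / (-l) with hM
    have hM3 : 3 < M := by
      have := div_pos hB hL
      linarith
    have hlM : l * M = 3 * l - (6 * l ^ 2 - 8 * l + 3) := by
      rw [hM]
      field_simp
      ring
    have p0 : eigenCubic l 0 < 0 := by simpa [eigenCubic] using hl
    have p1 : 0 < eigenCubic l (-1 / 2) := by unfold eigenCubic; nlinarith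
    have p2 : eigenCubic l (-2) < 0 := by unfold eigenCubic; nlinarith
    have p3 : 0 < eigenCubic l (-M) := by
      have : eigenCubic l (-M) =
          3 * (-l) * M ^ 2 + (3 * l ^ 2 - 8 * l + 6) * M - (-l) := by
        unfold eigenCubic
        linear_combination -M ^ 2 * hlM
      rw [this]
      nlinarith [mul_pos hC (by linarith : 0 < M)]
    obtain ⟨a, ha, ha', ha0⟩ := exists_root_of_mul_neg hc (by norm_num : (-1 / 2 : ℝ) < 0)
      (mul_neg_of_pos_of_neg p1 p0)
    obtain ⟨b, hb, hb', hb0⟩ := exists_root_of_mul_neg hc (by norm_num : (-2 : ℝ) < -1 / 2)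
      (mul_neg_of_neg_of_pos p2 p1)
    obtain ⟨c, hc, hc', hc0⟩ := exists_root_of_mul_neg hc (by linarith : -M < -2)
      (mul_neg_of_pos_of_neg p3 p2)
    refine ⟨![a, b, c], ?_, hinj a b c ?_ ?_ ?_⟩
    · simp [Fin.forall_fin_succ, ha0, hb0, hc0]
    · apply ne_of_lt; nlinarith
    · apply ne_of_lt; nlinarith
    · apply ne_of_lt; nlinarith
  · -- The values at `-M`, `0`, `1` and `M` alternate in sign.
    set M := 1 + ((6 * l ^ 2 - 8 * l + 3) + (3 * l ^ 2 - 8 * l + 6)) / l with hM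
    have hM1 : 1 < M := by
      have := div_pos (add_pos hB hC) hl
      linarith
    have hlM : l * M = l + (6 * l ^ 2 - 8 * l + 3) + (3 * l ^ 2 - 8 * l + 6) := by
      rw [hM]
      field_simp
      ring
    have p0 : 0 < eigenCubic l 0 := by simpa [eigenCubic] using hl
    have p1 : eigenCubic l 1 < 0 := by
      unfold eigenCubic
      nlinarith
    have p2 : 0 < eigenCubic l M := by
      have : eigenCubic l M =
          l * M ^ 2 + (3 * l ^ 2 - 8 * l + 6) * (M * (M - 1)) + l := by
        unfold eigenCubic
        linear_combination M ^ 2 * hlM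
      rw [this]
      have : 0 < M * (M - 1) := mul_pos (by linarith) (by linarith)
      positivity
    have p3 : eigenCubic l (-M) < 0 := by
      have : eigenCubic l (-M) = -(l * (M ^ 2 - 1) + 2 * (6 * l ^ 2 - 8 * l + 3) * M ^ 2 +
          (3 * l ^ 2 - 8 * l + 6) * (M * (M - 1))) := by
        unfold eigenCubic
        linear_combination -M ^ 2 * hlM
      rw [this, neg_neg_iff_pos]
      have : 0 < M * (M - 1) := mul_pos (by linarith) (by linarith)
      have : 0 < M ^ 2 - 1 := by nlinarith
      positivity
    obtain ⟨a, ha, ha', ha0⟩ := exists_root_of_mul_neg hc (by norm_num : (0 : ℝ) < 1)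
      (mul_neg_of_pos_of_neg p0 p1)
    obtain ⟨b, hb, hb', hb0⟩ := exists_root_of_mul_neg hc hM1
      (mul_neg_of_neg_of_pos p1 p2)
    obtain ⟨c, hc, hc', hc0⟩ := exists_root_of_mul_neg hc (by linarith : -M < 0)
      (mul_neg_of_neg_of_pos p3 p0)
    -- If `d` and `-d` are both roots, then `B d² = l` and `l d² = C`, so `B C = l²`; but
    -- `B C - l² = 18 (l - 1)⁴`.
    have hne : ∀ d, 0 < d → eigenCubic l d = 0 → d ^ 2 ≠ c ^ 2 := by
      intro d hd hd0 h
      have hcd : c = -d := by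
        rcases sq_eq_sq_iff_eq_or_eq_neg.mp h with h | h <;> linarith
      rw [hcd] at hc0
      unfold eigenCubic at hd0 hc0
      have e1 : (6 * l ^ 2 - 8 * l + 3) * d ^ 2 = l := by linarith
      have e2 : l * d ^ 2 = 3 * l ^ 2 - 8 * l + 6 := by
        apply mul_right_cancel₀ hd.ne'
        linarith
      have e3 : 18 * ((l - 1) ^ 2) ^ 2 = 0 := by
        linear_combination l * e1 - (6 * l ^ 2 - 8 * l + 3) * e2
      exact (pow_pos hl1 2).ne' (by linarith)
    refine ⟨![a, b, c], ?_, hinj a b c ?_ (hne a ha ha0) (hne b (by linarith) hb0)⟩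
    · simp [Fin.forall_fin_succ, ha0, hb0, hc0]
    · apply ne_of_lt; nlinarith

/-- The matrix of the involution `R = T J T⁻¹`, where `J` reverses the coordinates and the columns
of `T` are the leading coefficients of `(x + y)³ x²`, `(x + y)³ x y` and `(x + y)³ y²`. -/
def involution : Matrix (Fin 3) (Fin 3) ℝ := !![6, -3, 1; 15, -8, 3; 10, -6, 3]

/-- Real eigenvectors of `D⁻¹ R` with eigenvalues that have distinct squares. -/
theorem exists_eigenvectors {l : ℝ} (h0 : l ≠ 0) (h1 : l ≠ 1) :
    ∃ (η : Fin 3 → ℝ) (w : Fin 3 → Fin 3 → ℝ),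
      (Function.Injective fun k => η k ^ 2) ∧ (∀ k, w k ≠ 0) ∧
        ∀ k i, (involution.mulVec (w k)) i = η k * l ^ (i : ℕ) * w k i := by
  obtain ⟨μ, hμ, hinj⟩ := exists_roots_eigenCubic h0 h1
  have hdet : ∀ k, (involution - Matrix.diagonal fun i : Fin 3 =>
      μ k / l * l ^ (i : ℕ)).det = 0 := fun k => by
    have h := hμ k
    unfold eigenCubic at h
    rw [Matrix.det_fin_three]
    simp [involution, Matrix.diagonal]
    field_simp
    linear_combination -h
  choose w hw0 hw using fun k => Matrix.exists_mulVec_eq_zero_iff.mpr (hdet k)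
  refine ⟨fun k => μ k / l, w, fun k k' h => hinj ?_, hw0,
    fun k i => ?_⟩
  · simp only [div_pow] at h
    exact (div_left_inj' (pow_ne_zero 2 h0)).mp h
  · have h := congrFun (hw k) i
    rw [Matrix.sub_mulVec, Pi.sub_apply, Matrix.mulVec_diagonal, Pi.zero_apply, sub_eq_zero] at h
    exact h

/-! ### The osculating subspaces in normal form -/

theorem shearBasis_inl (b : Module.Basis (Fin 3 ⊕ Fin 3) ℂ (Fin 6 → ℂ)) (c : Fin 3 → ℂ)
    (m : Fin 3) : shearBasis b c (Sum.inl m) = b (Sum.inl m) + c m • b (Sum.inr m) := by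
  apply (shearBasis b c).repr.injective
  rw [Module.Basis.repr_self]
  ext (l | l)
  · rw [shearBasis_repr_inl]
    simp [Finsupp.single_apply]
  · rw [shearBasis_repr_inr]
    rcases eq_or_ne m l with rfl | h
    · simp
    · simp [h]

theorem mem_iff_of_shear {b : Module.Basis (Fin 3 ⊕ Fin 3) ℂ (Fin 6 → ℂ)}
    {U : Submodule ℂ (Fin 6 → ℂ)} (hU : Module.finrank ℂ U = 3) (c : Fin 3 → ℂ)
    (h : ∀ m, b (Sum.inl m) + c m • b (Sum.inr m) ∈ U) (v : Fin 6 → ℂ) :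
    v ∈ U ↔ ∀ m, b.repr v (Sum.inr m) = c m * b.repr v (Sum.inl m) := by
  have hle : coordSpan (shearBasis b c) leftIndices ≤ U := by
    rw [coordSpan_le_iff]
    rintro (m | m) hm
    · rw [shearBasis_inl]
      exact h m
    · simp [leftIndices] at hm
  have heq := Submodule.eq_of_le_of_finrank_eq hle (by
    rw [hU, finrank_coordSpan]
    decide)
  rw [← heq, PartialFlag.mem_coordSpan_leftIndices]
  simp only [shearBasis_repr_inr, sub_eq_zero]

/-- Four three-dimensional subspaces are in normal form as soon as they contain the vectors of the
normal form. -/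
theorem isNormalForm_of_mem {b : Module.Basis (Fin 3 ⊕ Fin 3) ℂ (Fin 6 → ℂ)} {κ : Fin 3 → ℂ}
    {W : Fin 4 → Submodule ℂ (Fin 6 → ℂ)} (hκ : Function.Injective κ)
    (hdim : ∀ i, Module.finrank ℂ (W i) = 3) (h0 : ∀ m, b (Sum.inl m) ∈ W 0)
    (h1 : ∀ m, b (Sum.inr m) ∈ W 1) (h2 : ∀ m, b (Sum.inl m) + b (Sum.inr m) ∈ W 2)
    (h3 : ∀ m, b (Sum.inl m) + κ m • b (Sum.inr m) ∈ W 3) : IsNormalForm b κ W where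
  injective := hκ
  mem_zero v := by simpa using mem_iff_of_shear (hdim 0) 0 (by simpa using h0) v
  mem_one v := by
    have := mem_iff_of_shear (b := b.reindex (Equiv.sumComm _ _)) (hdim 1) 0
      (by simpa using h1) v
    simp only [Module.Basis.repr_reindex_apply, Pi.zero_apply, zero_mul] at this
    exact this
  mem_two v := by simpa using mem_iff_of_shear (hdim 2) 1 (by simpa using h2) v
  mem_three v := mem_iff_of_shear (hdim 3) κ h3 v

theorem finrank_osculatingFlag_three (t : OnePoint ℝ) :
    Module.finrank ℂ (osculatingFlag 6 t 3) = 3 :=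
  (isCompleteFlag_osculatingFlag t).finrank_eq 3 (by norm_num)

theorem formCoeffs_det_ne_zero {s t : OnePoint ℝ} (h : s ≠ t) :
    (formCoeffs s).1 * (formCoeffs t).2 - (formCoeffs t).1 * (formCoeffs s).2 ≠ 0 := by
  induction s using OnePoint.rec with
  | infty =>
    induction t using OnePoint.rec with
    | infty => exact absurd rfl h
    | coe t =>
      change (1 : ℝ) * 1 - t * 0 ≠ 0
      norm_num
  | coe s =>
    induction t using OnePoint.rec with
    | infty =>
      change s * 0 - (1 : ℝ) * 1 ≠ 0
      norm_num
    | coe t =>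
      change s * 1 - t * 1 ≠ 0
      rw [mul_one, mul_one]
      exact sub_ne_zero.mpr fun h' => h (by rw [h'])

theorem pointForm_linear_relation {s t u : OnePoint ℝ} {a b c : ℝ}
    (h1 : a * (formCoeffs s).1 + b * (formCoeffs t).1 = c * (formCoeffs u).1)
    (h2 : a * (formCoeffs s).2 + b * (formCoeffs t).2 = c * (formCoeffs u).2) :
    C (a : ℂ) * pointForm s + C (b : ℂ) * pointForm t = C (c : ℂ) * pointForm u := by
  have e1 := congrArg (fun r : ℝ => (C (r : ℂ) : ℂ[X])) h1
  have e2 := congrArg (fun r : ℝ => (C (r : ℂ) : ℂ[X])) h2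
  simp only [Complex.ofReal_add, Complex.ofReal_mul, C_add, C_mul] at e1 e2
  unfold pointForm
  linear_combination X * e1 + e2

theorem isLinearBasis_smul_pointForm {s t : OnePoint ℝ} (h : s ≠ t) {a b : ℝ} (ha : a ≠ 0)
    (hb : b ≠ 0) : IsLinearBasis (C (a : ℂ) * pointForm s) (C (b : ℂ) * pointForm t) := by
  have hd := formCoeffs_det_ne_zero h
  unfold pointForm
  generalize formCoeffs s = p at *
  generalize formCoeffs t = q at *
  have ha' : (a : ℂ) ≠ 0 := by exact_mod_cast ha
  have hb' : (b : ℂ) ≠ 0 := by exact_mod_cast hb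
  have hd' : (p.1 * q.2 - q.1 * p.2 : ℂ) ≠ 0 := by exact_mod_cast hd
  have key : ∀ α β r₁ r₂ : ℂ, α * (a * p.1) + β * (b * q.1) = r₁ →
      α * (a * p.2) + β * (b * q.2) = r₂ →
      C r₁ * X + C r₂ = C α * (C (a : ℂ) * (C (p.1 : ℂ) * X + C (p.2 : ℂ))) +
        C β * (C (b : ℂ) * (C (q.1 : ℂ) * X + C (q.2 : ℂ))) := by
    rintro α β _ _ rfl rfl
    simp only [C_add, C_mul]
    ring
  obtain ⟨D, hD⟩ : ∃ D : ℂ, D = p.1 * q.2 - q.1 * p.2 := ⟨_, rfl⟩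
  rw [← hD] at hd'
  constructor
  · refine ⟨-q.1 / (D * a), p.1 / (D * b), ?_⟩
    rw [← key _ _ 0 1 (by field_simp; ring) (by field_simp; linear_combination -hD)]
    simp
  · refine ⟨q.2 / (D * a), -p.2 / (D * b), ?_⟩
    rw [← key _ _ 1 0 (by field_simp; linear_combination -hD) (by field_simp; ring)]
    simp

/-- Four distinct points in standard position: after rescaling, the linear forms of four distinct
points are `x`, `y`, `x + y` and `x + l y` with `l ≠ 0, 1`. -/
theorem exists_standard_forms {t : Fin 4 → OnePoint ℝ} (ht : Function.Injective t) :
    ∃ a b c d l : ℝ, l ≠ 0 ∧ l ≠ 1 ∧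
      IsLinearBasis (C (a : ℂ) * pointForm (t 0)) (C (b : ℂ) * pointForm (t 1)) ∧
      C (a : ℂ) * pointForm (t 0) + C (b : ℂ) * pointForm (t 1) =
        C (c : ℂ) * pointForm (t 2) ∧
      C (a : ℂ) * pointForm (t 0) + C (l : ℂ) * (C (b : ℂ) * pointForm (t 1)) =
        C (d : ℂ) * pointForm (t 3) := by
  have h : ∀ i j, i ≠ j → (formCoeffs (t i)).1 * (formCoeffs (t j)).2 -
      (formCoeffs (t j)).1 * (formCoeffs (t i)).2 ≠ 0 :=
    fun i j hij => formCoeffs_det_ne_zero fun h => hij (ht h)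
  have h01 := h 0 1 (by decide)
  have h21 := h 2 1 (by decide)
  have h02 := h 0 2 (by decide)
  have h31 := h 3 1 (by decide)
  have h03 := h 0 3 (by decide)
  have h23 := h 2 3 (by decide)
  have hbasis := isLinearBasis_smul_pointForm (fun h => absurd (ht h) (by decide) : t 0 ≠ t 1)
    h21 h02
  -- The coefficients come from Cramer's rule for three linear forms in two variables.
  have hrel (l d : ℝ) := pointForm_linear_relation (s := t 0) (t := t 1) (u := t 3)
    (a := (formCoeffs (t 2)).1 * (formCoeffs (t 1)).2 -
      (formCoeffs (t 1)).1 * (formCoeffs (t 2)).2)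
    (b := l * ((formCoeffs (t 0)).1 * (formCoeffs (t 2)).2 -
      (formCoeffs (t 2)).1 * (formCoeffs (t 0)).2)) (c := d)
  have hrel' := pointForm_linear_relation (s := t 0) (t := t 1) (u := t 2)
    (a := (formCoeffs (t 2)).1 * (formCoeffs (t 1)).2 -
      (formCoeffs (t 1)).1 * (formCoeffs (t 2)).2)
    (b := (formCoeffs (t 0)).1 * (formCoeffs (t 2)).2 -
      (formCoeffs (t 2)).1 * (formCoeffs (t 0)).2)
    (c := (formCoeffs (t 0)).1 * (formCoeffs (t 1)).2 -
      (formCoeffs (t 1)).1 * (formCoeffs (t 0)).2) (by ring) (by ring)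
  have hclear : ∀ A D E P Q r₀ r₁ r₃ : ℝ, D ≠ 0 → E ≠ 0 → r₀ * D + P * r₁ = Q * r₃ →
      A * r₀ + A * P / (D * E) * E * r₁ = A * Q / D * r₃ := by
    intro A D E P Q r₀ r₁ r₃ hD hE h
    field_simp
    linear_combination A * h
  generalize formCoeffs (t 0) = f0 at *
  generalize formCoeffs (t 1) = f1 at *
  generalize formCoeffs (t 2) = f2 at *
  generalize formCoeffs (t 3) = f3 at *
  refine ⟨_, _, _, (f2.1 * f1.2 - f1.1 * f2.2) * (f0.1 * f1.2 - f1.1 * f0.2) /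
      (f3.1 * f1.2 - f1.1 * f3.2),
    (f2.1 * f1.2 - f1.1 * f2.2) * (f0.1 * f3.2 - f3.1 * f0.2) /
      ((f3.1 * f1.2 - f1.1 * f3.2) * (f0.1 * f2.2 - f2.1 * f0.2)),
    div_ne_zero (mul_ne_zero h21 h03) (mul_ne_zero h31 h02), ?_, hbasis, hrel', ?_⟩
  · rw [ne_eq, div_eq_one_iff_eq (mul_ne_zero h31 h02)]
    -- The Plücker relation: the difference of the two sides is a product of two minors.
    intro heq
    exact mul_ne_zero h01 h23 (by linear_combination heq)
  · have := hrel ((f2.1 * f1.2 - f1.1 * f2.2) * (f0.1 * f3.2 - f3.1 * f0.2) /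
        ((f3.1 * f1.2 - f1.1 * f3.2) * (f0.1 * f2.2 - f2.1 * f0.2)))
      ((f2.1 * f1.2 - f1.1 * f2.2) * (f0.1 * f1.2 - f1.1 * f0.2) / (f3.1 * f1.2 - f1.1 * f3.2))
      (hclear _ _ _ _ _ _ _ _ h31 h02 (by ring)) (hclear _ _ _ _ _ _ _ _ h31 h02 (by ring))
    rw [Complex.ofReal_mul, C_mul, mul_assoc] at this
    exact this

theorem quinticVec_mem_of_eq {t : OnePoint ℝ} {f ℓ q : ℂ[X]} {c : ℂ}
    (hℓ : ℓ = C c * pointForm t) (hf : f = ℓ ^ 3 * q) (hq : q.natDegree ≤ 2) :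
    quinticVec f ∈ osculatingFlag 6 t 3 := by
  have : f = pointForm t ^ 3 * (c ^ 3 • q) := by
    rw [hf, hℓ, smul_eq_C_mul, C_pow]
    ring
  rw [this]
  exact quinticVec_mem_osculatingFlag t ((natDegree_smul_le _ _).trans hq)

/-- The quadratic form with coefficient vector `c` in the linear forms `x` and `y`. -/
def quadraticForm (x y : ℂ[X]) (c : Fin 3 → ℂ) : ℂ[X] :=
  C (c 0) * x ^ 2 + C (c 1) * (x * y) + C (c 2) * y ^ 2

theorem natDegree_quadraticForm_le {x y : ℂ[X]} (hx : x.natDegree ≤ 1) (hy : y.natDegree ≤ 1)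
    (c : Fin 3 → ℂ) : (quadraticForm x y c).natDegree ≤ 2 := by
  have h1 : (x ^ 2).natDegree ≤ 2 := natDegree_pow_le_of_le 2 hx
  have h2 : (x * y).natDegree ≤ 2 := natDegree_mul_le_of_le hx hy
  have h3 : (y ^ 2).natDegree ≤ 2 := natDegree_pow_le_of_le 2 hy
  exact natDegree_add_le_of_degree_le (natDegree_add_le_of_degree_le
    ((natDegree_C_mul_le _ _).trans h1) ((natDegree_C_mul_le _ _).trans h2))
    ((natDegree_C_mul_le _ _).trans h3)

/-- The parametrization `(z, w) ↦ x³ (R z) + y³ (J w)` of `ℂ⁶`, where a vector of `ℂ³` stands for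
the quadratic form in `x`, `y` with these coefficients, `R` is `involution` and `J` reverses the
coordinates. The subspaces of the multiples of `x³`, `y³` and `(x + y)³` are `w = 0`, `z = 0` and
`z = w`. -/
def pairMap (x y : ℂ[X]) : (Fin 3 → ℂ) × (Fin 3 → ℂ) →ₗ[ℂ] (Fin 6 → ℂ) where
  toFun z := quinticVec
    (x ^ 3 * quadraticForm x y ![6 * z.1 0 - 3 * z.1 1 + z.1 2,
        15 * z.1 0 - 8 * z.1 1 + 3 * z.1 2, 10 * z.1 0 - 6 * z.1 1 + 3 * z.1 2] +
      y ^ 3 * quadraticForm x y ![z.2 2, z.2 1, z.2 0])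
  map_add' z w := by
    rw [← map_add]
    congr 1
    simp [quadraticForm]
    ring
  map_smul' c z := by
    rw [RingHom.id_apply, ← map_smul, smul_eq_C_mul]
    congr 1
    simp [quadraticForm]
    ring

theorem pairMap_apply (x y : ℂ[X]) (z w : Fin 3 → ℂ) : pairMap x y (z, w) = quinticVec
    (x ^ 3 * quadraticForm x y ![6 * z 0 - 3 * z 1 + z 2, 15 * z 0 - 8 * z 1 + 3 * z 2,
        10 * z 0 - 6 * z 1 + 3 * z 2] + y ^ 3 * quadraticForm x y ![w 2, w 1, w 0]) := rfl

theorem pairMap_injective {x y : ℂ[X]} (h : IsLinearBasis x y) :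
    Function.Injective (pairMap x y) := by
  rw [injective_iff_map_eq_zero]
  rintro ⟨z, w⟩ hzw
  have hsum : ∑ r : Fin 6, (![6 * z 0 - 3 * z 1 + z 2, 15 * z 0 - 8 * z 1 + 3 * z 2,
      10 * z 0 - 6 * z 1 + 3 * z 2, w 2, w 1, w 0] : Fin 6 → ℂ) r • monomialBasis h r = 0 := by
    rw [← hzw, pairMap_apply]
    simp only [monomialBasis_apply, ← map_smul, ← map_sum]
    congr 1
    simp [Fin.sum_univ_six, quadraticForm, smul_eq_C_mul]
    ring
  have hc := Fintype.linearIndependent_iff.mp (monomialBasis h).linearIndependent _ hsum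
  have c0 : 6 * z 0 - 3 * z 1 + z 2 = 0 := hc 0
  have c1 : 15 * z 0 - 8 * z 1 + 3 * z 2 = 0 := hc 1
  have c2 : 10 * z 0 - 6 * z 1 + 3 * z 2 = 0 := hc 2
  have hw : w = 0 := by
    ext i
    fin_cases i
    exacts [hc 5, hc 4, hc 3]
  have hz : z = 0 := by
    ext i
    fin_cases i
    · change z 0 = 0
      linear_combination 6 * c0 - 3 * c1 + c2
    · change z 1 = 0
      linear_combination 15 * c0 - 8 * c1 + 3 * c2
    · change z 2 = 0
      linear_combination 10 * c0 - 6 * c1 + 3 * c2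
  rw [hw, hz]
  rfl

theorem exists_real_quinticVec {f : ℂ[X]} (hf : f ∈ (mapRingHom Complex.ofRealHom).range) :
    ∃ r : Fin 6 → ℝ, quinticVec f = fun m => (r m : ℂ) := by
  obtain ⟨g, rfl⟩ := hf
  refine ⟨fun m => g.coeff (5 - m) / Nat.choose 5 m, funext fun m => ?_⟩
  simp [quinticVec_apply]

theorem C_ofReal_mem_range (r : ℝ) : (C (r : ℂ) : ℂ[X]) ∈ (mapRingHom Complex.ofRealHom).range :=
  ⟨C r, by simp⟩

theorem smul_pointForm_mem_range (a : ℝ) (t : OnePoint ℝ) :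
    C (a : ℂ) * pointForm t ∈ (mapRingHom Complex.ofRealHom).range :=
  mul_mem (C_ofReal_mem_range a) (add_mem (mul_mem (C_ofReal_mem_range _) ⟨X, by simp⟩)
    (C_ofReal_mem_range _))

theorem quadraticForm_mem_range {x y : ℂ[X]} (hx : x ∈ (mapRingHom Complex.ofRealHom).range)
    (hy : y ∈ (mapRingHom Complex.ofRealHom).range) {c : Fin 3 → ℂ}
    (hc : ∀ i, ∃ r : ℝ, c i = r) :
    quadraticForm x y c ∈ (mapRingHom Complex.ofRealHom).range := by
  choose r hr using hc
  unfold quadraticForm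
  rw [hr 0, hr 1, hr 2]
  exact add_mem (add_mem (mul_mem (C_ofReal_mem_range _) (pow_mem hx 2))
    (mul_mem (C_ofReal_mem_range _) (mul_mem hx hy)))
    (mul_mem (C_ofReal_mem_range _) (pow_mem hy 2))

theorem exists_real_pairMap {x y : ℂ[X]} (hx : x ∈ (mapRingHom Complex.ofRealHom).range)
    (hy : y ∈ (mapRingHom Complex.ofRealHom).range) (z w : Fin 3 → ℝ) :
    ∃ r : Fin 6 → ℝ, pairMap x y (fun i => (z i : ℂ), fun i => (w i : ℂ)) =
      fun m => (r m : ℂ) := by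
  rw [pairMap_apply]
  apply exists_real_quinticVec
  refine add_mem (mul_mem (pow_mem hx 3) (quadraticForm_mem_range hx hy fun i => ?_))
    (mul_mem (pow_mem hy 3) (quadraticForm_mem_range hx hy fun i => ?_))
  · refine ⟨![6 * z 0 - 3 * z 1 + z 2, 15 * z 0 - 8 * z 1 + 3 * z 2,
      10 * z 0 - 6 * z 1 + 3 * z 2] i, ?_⟩
    fin_cases i <;> simp
  · refine ⟨![w 2, w 1, w 0] i, ?_⟩
    fin_cases i <;> simp

/-- Vectors with distinct eigenvalues are independent, also after complexification. -/
theorem linearIndependent_complex_eigenvectors {l : ℝ} (hl : l ≠ 0) {η : Fin 3 → ℝ}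
    {w : Fin 3 → Fin 3 → ℝ} (hη : Function.Injective η) (hw0 : ∀ k, w k ≠ 0)
    (hw : ∀ k i, (involution.mulVec (w k)) i = η k * l ^ (i : ℕ) * w k i) :
    LinearIndependent ℂ fun k i => (w k i : ℂ) := by
  let M : Matrix (Fin 3) (Fin 3) ℂ := .of fun i j => (involution i j / l ^ (i : ℕ) : ℂ)
  refine Module.End.eigenvectors_linearIndependent' (Matrix.toLin' M) (fun k => (η k : ℂ))
    (fun k k' h => hη (Complex.ofReal_injective h)) _ fun k => ⟨?_, fun h => hw0 k ?_⟩
  · rw [Module.End.mem_eigenspace_iff, Matrix.toLin'_apply]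
    ext i
    have h : ((involution.mulVec (w k) i : ℝ) : ℂ) / l ^ (i : ℕ) = η k * w k i := by
      have : (l : ℂ) ≠ 0 := by exact_mod_cast hl
      rw [hw k i]
      push_cast
      field_simp
    rw [Pi.smul_apply, smul_eq_mul, ← h]
    simp only [Matrix.mulVec, dotProduct, M, Matrix.of_apply, Complex.ofReal_sum,
      Complex.ofReal_mul, Finset.sum_div]
    exact Finset.sum_congr rfl fun j _ => by ring
  · ext i
    exact Complex.ofReal_injective (congrFun h i)

/-- The four osculating three-spaces have a real normal form. -/
theorem exists_isNormalForm {t : Fin 4 → OnePoint ℝ} (ht : Function.Injective t) :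
    ∃ (b : Module.Basis (Fin 3 ⊕ Fin 3) ℂ (Fin 6 → ℂ)) (κ : Fin 3 → ℂ),
      (∀ i, ∃ r : Fin 6 → ℝ, b i = fun m => (r m : ℂ)) ∧
        IsNormalForm b κ fun i => osculatingFlag 6 (t i) 3 := by
  obtain ⟨a, b, c, d, l, hl0, hl1, hxy, hc, hd⟩ := exists_standard_forms ht
  obtain ⟨η, w, hη2, hw0, hw⟩ := exists_eigenvectors hl0 hl1
  set x := C (a : ℂ) * pointForm (t 0) with hx
  set y := C (b : ℂ) * pointForm (t 1) with hy
  have hxr : x ∈ (mapRingHom Complex.ofRealHom).range := smul_pointForm_mem_range a _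
  have hyr : y ∈ (mapRingHom Complex.ofRealHom).range := smul_pointForm_mem_range b _
  have hdeg : ∀ (e : ℝ) (s : OnePoint ℝ), (C (e : ℂ) * pointForm s).natDegree ≤ 1 :=
    fun e s => (natDegree_C_mul_le _ _).trans natDegree_linear_le
  have hx1 : x.natDegree ≤ 1 := hdeg a _
  have hy1 : y.natDegree ≤ 1 := hdeg b _
  have hq := natDegree_quadraticForm_le hx1 hy1
  have hη : Function.Injective η := fun k k' h => hη2 (by simp only [h])
  let e := basisOfLinearIndependentOfCardEqFinrank
    (linearIndependent_complex_eigenvectors hl0 hη hw0 hw) (by simp)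
  have he : ∀ k, e k = fun i => (w k i : ℂ) := fun k => by simp [e]
  let B := (e.prod e).map (LinearMap.linearEquivOfInjective (pairMap x y) (pairMap_injective hxy)
    (by simp))
  have hBl : ∀ k, B (Sum.inl k) = pairMap x y (fun i => (w k i : ℂ), 0) := fun k => by
    simp [B, he]
  have hBr : ∀ k, B (Sum.inr k) = pairMap x y (0, fun i => (w k i : ℂ)) := fun k => by
    simp [B, he]
  have hBlr : ∀ k (s : ℂ), B (Sum.inl k) + s • B (Sum.inr k) =
      pairMap x y (fun i => (w k i : ℂ), fun i => s * (w k i : ℂ)) := fun k s => by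
    rw [hBl, hBr, ← map_smul, ← map_add]
    congr 1
    ext i <;> simp
  have hC : ∀ (n : ℕ) [n.AtLeastTwo], (C (OfNat.ofNat n : ℂ) : ℂ[X]) = OfNat.ofNat n :=
    fun n _ => map_ofNat C n
  refine ⟨B, fun k => ((η k ^ 2 * l ^ 5 : ℝ) : ℂ), ?_, isNormalForm_of_mem ?_
    (fun i => finrank_osculatingFlag_three _) (fun k => ?_) (fun k => ?_) (fun k => ?_)
    (fun k => ?_)⟩
  · have hzero : (fun i => ((0 : Fin 3 → ℝ) i : ℂ)) = 0 := by ext; simp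
    rintro (k | k)
    · rw [hBl, ← hzero]
      exact exists_real_pairMap hxr hyr (w k) 0
    · rw [hBr, ← hzero]
      exact exists_real_pairMap hxr hyr 0 (w k)
  · intro k k' h
    exact hη2 (mul_right_cancel₀ (pow_ne_zero 5 hl0) (Complex.ofReal_injective h))
  · rw [hBl, pairMap_apply]
    have hz : quadraticForm x y ![(0 : Fin 3 → ℂ) 2, (0 : Fin 3 → ℂ) 1, (0 : Fin 3 → ℂ) 0] = 0 := by
      simp [quadraticForm]
    rw [hz, mul_zero, add_zero]
    exact quinticVec_mem_of_eq hx rfl (hq _)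
  · rw [hBr, pairMap_apply]
    refine quinticVec_mem_of_eq hy (q := quadraticForm x y ![w k 2, w k 1, w k 0]) ?_ (hq _)
    simp [quadraticForm]
  · have := hBlr k 1
    rw [one_smul] at this
    rw [this, pairMap_apply]
    -- With `R = T J T⁻¹`, the form is `(x + y)³` times the form of `J T⁻¹ w`.
    refine quinticVec_mem_of_eq hc (q := quadraticForm x y
      ![6 * w k 0 - 3 * w k 1 + w k 2, w k 1 - 3 * w k 0, w k 0]) ?_ (hq _)
    simp [quadraticForm, hC]
    ring
  · rw [hBlr, pairMap_apply]
    -- The form is `(x + l y)³` times the form of `η T⁻¹ w`, taken in `x` and `l y`.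
    refine quinticVec_mem_of_eq hd (q := quadraticForm x y
      ![η k * w k 0, η k * l * (w k 1 - 3 * w k 0),
        η k * l ^ 2 * (6 * w k 0 - 3 * w k 1 + w k 2)]) ?_ (hq _)
    -- The eigenvector equations, in the ring of polynomials.
    have e0 : (C (6 * w k 0 - 3 * w k 1 + w k 2 : ℂ) : ℂ[X]) = C (η k * w k 0 : ℂ) := by
      congr 1
      have := hw k 0
      simp [involution, Matrix.mulVec, dotProduct, Fin.sum_univ_three] at this
      have := congrArg (fun r : ℝ => (r : ℂ)) this
      push_cast at this
      linear_combination this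
    have e1 : (C (15 * w k 0 - 8 * w k 1 + 3 * w k 2 : ℂ) : ℂ[X]) = C (η k * l * w k 1 : ℂ) := by
      congr 1
      have := hw k 1
      simp [involution, Matrix.mulVec, dotProduct, Fin.sum_univ_three] at this
      have := congrArg (fun r : ℝ => (r : ℂ)) this
      push_cast at this
      linear_combination this
    have e2 : (C (10 * w k 0 - 6 * w k 1 + 3 * w k 2 : ℂ) : ℂ[X]) =
        C (η k * l ^ 2 * w k 2 : ℂ) := by
      congr 1
      have := hw k 2
      simp [involution, Matrix.mulVec, dotProduct, Fin.sum_univ_three] at this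
      have := congrArg (fun r : ℝ => (r : ℂ)) this
      push_cast at this
      linear_combination this
    simp only [map_add, map_sub, map_mul, map_pow, hC] at e0 e1 e2
    simp [quadraticForm, hC]
    linear_combination (x ^ 5 - C (η k : ℂ) * C (l : ℂ) ^ 5 * y ^ 5) * e0 +
      (x ^ 4 * y - C (η k : ℂ) * C (l : ℂ) ^ 4 * x * y ^ 4) * e1 +
      (x ^ 3 * y ^ 2 - C (η k : ℂ) * C (l : ℂ) ^ 3 * x ^ 2 * y ^ 3) * e2

end

theorem mainTheorem5 (t : Fin 4 → OnePoint ℝ) (ht : Function.Injective t) :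
    (⋂ i, schubertVariety ![2, 4] perm142536 (osculatingFlag 6 (t i))).ncard = 6 ∧
    ∀ E ∈ ⋂ i, schubertVariety ![2, 4] perm142536 (osculatingFlag 6 (t i)),
      E.IsReal ∧
      E.TransverseAt (fun _ : Fin 4 => perm142536) (fun i => osculatingFlag 6 (t i)) := by
  obtain ⟨b, κ, hreal, hW⟩ := exists_isNormalForm ht
  have hF := fun i => isCompleteFlag_osculatingFlag (t i)
  rw [hW.iInter_schubertVariety_eq_range hF]
  constructor
  · rw [← Set.image_univ, Set.ncard_image_of_injective _ (blockFlag_injective b), Set.ncard_univ,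
      Nat.card_eq_fintype_card]
    decide
  · rintro _ ⟨p, rfl⟩
    exact ⟨blockFlag_isReal hreal p, hW.blockFlag_transverseAt hF p⟩
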